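/- Let $\mathsf{RCA}_0$ be the usual subsystem of second-order arithmetic (basic axioms, $\Sigma^0_1$ induction, $\Delta^0_1$ comprehension). Write $k$ for the set $\{0,\dots,k-1\}$ and $[X]^n$ for the set of $n$-element subsets of $X\subseteq\mathbb N$, where $0\in\mathbb N$. The following are statements of second-order arithmetic. - For $n\ge 1$, $\mathbb Z\text{-}\mathsf{RT}^n$ says: for every $k$ and every colouring $c:[\mathbb N]^n\to k$ that is $\mathbb Z$-invariant, i.e. $c(\{x_1,\dots,x_n\})=c(\{x_1+z,\dots,x_n+z\})$ for all $\{x_1,\dots,x_n\}\in[\mathbb N]^n$ and $z\in\mathbb N$, there is an infinite set $X\subseteq\mathbb N$ such that $c$ is constant on $[X]^n$. - For $d\ge 1$, $\mathsf{AHT}^d$ says: for every $k$ and every $c:\mathbb N^d\to k$ there is an infinite set $Y\subseteq\mathbb N$ with increasing enumeration $\langle y_n\mid n\in\mathbb N\rangle$ such that $c$ is constant on the set of all tuples $$\left(\sum_{i=k_0}^{k_1}y_i,\ \sum_{i=k_1+1}^{k_2}y_i,\ \dots,\ \sum_{i=k_{d-1}+1}^{k_d}y_i\right),\qquad k_0\le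 k_1<k_2<\dots<k_d.$$ - $\mathsf{AHT}$ says: for every $k$ and every $c:\mathbb N\to k$ there is an infinite set $Y\subseteq\mathbb N$ with increasing enumeration $\langle y_n\mid n\in\mathbb N\rangle$ such that $c$ is constant on $\{y_n+y_{n+1}+\dots+y_{n+l}\mid n,l\in\mathbb N\}$. Then, for each (standard) natural number $d\ge 1$, $\mathsf{RCA}_0\vdash\mathbb Z\text{-}\mathsf{RT}^{d+1}\leftrightarrow\mathsf{AHT}^d$. In particular, $\mathsf{RCA}_0\vdash\mathsf{AHT}\leftrightarrow\mathbb Z\text{-}\mathsf{RT}^2$. -/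

import Mathlib

namespace SOA

/-! ## The language of second-order arithmetic -/

/-- Number terms of the two-sorted language with `0, 1, +, ·, =, <, ∈`. -/
inductive Tm : Type
  | var (i : ℕ) : Tm
  | zero : Tm
  | one : Tm
  | add (s t : Tm) : Tm
  | mul (s t : Tm) : Tm

/-- Formulas, up to renaming of bound variables (de Bruijn indices). Number variables and set
variables are indexed separately: `all` binds number variable `0` and `allSet` binds set
variable `0`, the variable `i + 1` below the quantifier being the variable `i` outside of it. -/
inductive Fm : Type
  | eq (s t : Tm) : Fm
  | lt (s t : Tm) : Fm
  | mem (t : Tm) (X : ℕ) : Fm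
  | fls : Fm
  | imp (φ ψ : Fm) : Fm
  | all (φ : Fm) : Fm
  | allSet (φ : Fm) : Fm

/-- Simultaneous substitution of terms for number variables. -/
def Tm.subst (σ : ℕ → Tm) : Tm → Tm
  | .var i => σ i
  | .zero => .zero
  | .one => .one
  | .add s t => .add (s.subst σ) (t.subst σ)
  | .mul s t => .mul (s.subst σ) (t.subst σ)

def Tm.shift (t : Tm) : Tm := t.subst fun i => .var (i + 1)

/-- `consVar a f` is the sequence `a, f 0, f 1, …`. -/
def consVar {α : Type} (a : α) (f : ℕ → α) : ℕ → α
  | 0 => a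
  | i + 1 => f i

/-- Capture-avoiding simultaneous substitution: terms `σ` for the free number variables and set
variables `ρ` for the free set variables. -/
def Fm.subst : (ℕ → Tm) → (ℕ → ℕ) → Fm → Fm
  | σ, _, .eq s t => .eq (s.subst σ) (t.subst σ)
  | σ, _, .lt s t => .lt (s.subst σ) (t.subst σ)
  | σ, ρ, .mem t X => .mem (t.subst σ) (ρ X)
  | _, _, .fls => .fls
  | σ, ρ, .imp φ ψ => .imp (φ.subst σ ρ) (ψ.subst σ ρ)
  | σ, ρ, .all φ => .all (φ.subst (consVar (.var 0) fun i => (σ i).shift) ρ)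
  | σ, ρ, .allSet φ => .allSet (φ.subst σ (consVar 0 fun X => ρ X + 1))

/-- Make room for a new number variable `0`. -/
def Fm.shift (φ : Fm) : Fm := φ.subst (fun i => .var (i + 1)) id

/-- Make room for a new set variable `0`. -/
def Fm.shiftSet (φ : Fm) : Fm := φ.subst .var (· + 1)

/-- `φ(t)`, for a formula `φ` below a number quantifier. -/
def Fm.inst (φ : Fm) (t : Tm) : Fm := φ.subst (consVar t .var) id

/-- `φ(X)`, for a formula `φ` below a set quantifier. -/
def Fm.instSet (φ : Fm) (X : ℕ) : Fm := φ.subst .var (consVar X id)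

def Fm.neg (φ : Fm) : Fm := .imp φ .fls
def Fm.tru : Fm := Fm.neg .fls
def Fm.and (φ ψ : Fm) : Fm := .neg (.imp φ (.neg ψ))
def Fm.or (φ ψ : Fm) : Fm := .imp (.neg φ) ψ
def Fm.iff (φ ψ : Fm) : Fm := .and (.imp φ ψ) (.imp ψ φ)
def Fm.ex (φ : Fm) : Fm := .neg (.all (.neg φ))
def Fm.exSet (φ : Fm) : Fm := .neg (.allSet (.neg φ))

infixr:55 " ⋏ " => Fm.and
infixr:54 " ⋎ " => Fm.or
infixr:53 " ➝ " => Fm.imp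
infix:52 " ⭤ " => Fm.iff

/-! ## Classical two-sorted first-order provability -/

/-- `Derives T Γ φ`: natural-deduction derivability of `φ` from the axioms `T` and the finitely
many hypotheses `Γ`. Free variables of axioms are read universally: a generalization must
respect the hypotheses in `Γ` only. -/
inductive Derives (T : Set Fm) : List Fm → Fm → Prop
  | ax {Γ : List Fm} {φ : Fm} : φ ∈ T → Derives T Γ φ
  | hyp {Γ : List Fm} {φ : Fm} : φ ∈ Γ → Derives T Γ φ
  | impI {Γ : List Fm} {φ ψ : Fm} : Derives T (φ :: Γ) ψ → Derives T Γ (φ ➝ ψ)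
  | impE {Γ : List Fm} {φ ψ : Fm} : Derives T Γ (φ ➝ ψ) → Derives T Γ φ → Derives T Γ ψ
  | raa {Γ : List Fm} {φ : Fm} : Derives T (φ.neg :: Γ) .fls → Derives T Γ φ
  | allI {Γ : List Fm} {φ : Fm} : Derives T (Γ.map Fm.shift) φ → Derives T Γ (.all φ)
  | allE {Γ : List Fm} {φ : Fm} (t : Tm) : Derives T Γ (.all φ) → Derives T Γ (φ.inst t)
  | allSetI {Γ : List Fm} {φ : Fm} :
      Derives T (Γ.map Fm.shiftSet) φ → Derives T Γ (.allSet φ)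
  | allSetE {Γ : List Fm} {φ : Fm} (X : ℕ) :
      Derives T Γ (.allSet φ) → Derives T Γ (φ.instSet X)
  | eqI {Γ : List Fm} (t : Tm) : Derives T Γ (.eq t t)
  | eqE {Γ : List Fm} {s t : Tm} (φ : Fm) :
      Derives T Γ (.eq s t) → Derives T Γ (φ.inst s) → Derives T Γ (φ.inst t)

/-- `T ⊢ φ`. -/
def Proves (T : Set Fm) (φ : Fm) : Prop := Derives T [] φ

/-! ## The theory RCA₀ -/

/-- Bounded-quantifier (`Σ⁰₀`) formulas: every quantifier is of the form `∀ n < t` or `∃ n < t`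
with a term `t` that does not contain `n`. -/
inductive Fm.Bounded : Fm → Prop
  | eq (s t : Tm) : Bounded (.eq s t)
  | lt (s t : Tm) : Bounded (.lt s t)
  | mem (t : Tm) (X : ℕ) : Bounded (.mem t X)
  | fls : Bounded .fls
  | imp {φ ψ : Fm} : Bounded φ → Bounded ψ → Bounded (φ ➝ ψ)
  | ball {φ : Fm} (t : Tm) : Bounded φ → Bounded (.all (.lt (.var 0) t.shift ➝ φ))
  | bex {φ : Fm} (t : Tm) : Bounded φ → Bounded (.ex (.lt (.var 0) t.shift ⋏ φ))

/-- `Σ⁰₁` formulas `∃ n θ`, with `θ` bounded. -/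
def Fm.IsSigma1 (φ : Fm) : Prop := ∃ θ : Fm, θ.Bounded ∧ φ = .ex θ

/-- `Π⁰₁` formulas `∀ n θ`, with `θ` bounded. -/
def Fm.IsPi1 (φ : Fm) : Prop := ∃ θ : Fm, θ.Bounded ∧ φ = .all θ

/-- The basic axioms, with free variables `m = var 0` and `n = var 1`. -/
inductive BasicAxiom : Fm → Prop
  | succ_ne_zero : BasicAxiom (Fm.neg (.eq (.add (.var 0) .one) .zero))
  | succ_inj : BasicAxiom
      (.eq (.add (.var 0) .one) (.add (.var 1) .one) ➝ .eq (.var 0) (.var 1))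
  | add_zero : BasicAxiom (.eq (.add (.var 0) .zero) (.var 0))
  | add_succ : BasicAxiom
      (.eq (.add (.var 0) (.add (.var 1) .one)) (.add (.add (.var 0) (.var 1)) .one))
  | mul_zero : BasicAxiom (.eq (.mul (.var 0) .zero) .zero)
  | mul_succ : BasicAxiom
      (.eq (.mul (.var 0) (.add (.var 1) .one)) (.add (.mul (.var 0) (.var 1)) (.var 0)))
  | not_lt_zero : BasicAxiom (Fm.neg (.lt (.var 0) .zero))
  | lt_succ : BasicAxiom
      (.lt (.var 0) (.add (.var 1) .one) ⭤ (.lt (.var 0) (.var 1) ⋎ .eq (.var 0) (.var 1)))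

/-- `φ(0) ∧ ∀ n (φ(n) → φ(n + 1)) → ∀ n φ(n)`; the variable `n` is `var 0` in `φ`. -/
def inductionAxiom (φ : Fm) : Fm :=
  (φ.inst .zero ⋏
    .all (φ ➝ φ.subst (consVar (.add (.var 0) .one) fun i => .var (i + 1)) id)) ➝ .all φ

/-- `∀ n (φ(n) ↔ ψ(n)) → ∃ X ∀ n (n ∈ X ↔ φ(n))`, with `X` not free in `φ`; the variable `n` is
`var 0` in `φ` and `ψ`. -/
def comprehensionAxiom (φ ψ : Fm) : Fm :=
  .all (φ ⭤ ψ) ➝ .exSet (.all (.mem (.var 0) 0 ⭤ φ.shiftSet))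

/-- `RCA₀`: the basic axioms, `Σ⁰₁` induction and `Δ⁰₁` comprehension, where `φ` and `ψ` may
contain further free number and set variables as parameters. -/
inductive RCA0 : Set Fm
  | basic {φ : Fm} : BasicAxiom φ → RCA0 φ
  | induction {φ : Fm} : φ.IsSigma1 → RCA0 (inductionAxiom φ)
  | comprehension {φ ψ : Fm} : φ.IsSigma1 → ψ.IsPi1 → RCA0 (comprehensionAxiom φ ψ)

/-! ## Quantification over named variables -/

/-- `∀ x φ`, for the free number variable `x` of `φ`: it becomes the bound index `0`. -/
def All (x : ℕ) (φ : Fm) : Fm :=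
  .all (φ.subst (fun i => if i = x then .var 0 else .var (i + 1)) id)

/-- `∃ x φ`. -/
def Ex (x : ℕ) (φ : Fm) : Fm := .neg (All x φ.neg)

/-- `∀ X φ`, for the free set variable `X` of `φ`. -/
def AllSet (X : ℕ) (φ : Fm) : Fm :=
  .allSet (φ.subst .var fun i => if i = X then 0 else i + 1)

/-- `∃ X φ`. -/
def ExSet (X : ℕ) (φ : Fm) : Fm := .neg (AllSet X φ.neg)

/-- `∀ x₁ … ∀ xₙ φ`. -/
def AllList (xs : List ℕ) (φ : Fm) : Fm := xs.foldr All φ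

/-- `∃ x₁ … ∃ xₙ φ`. -/
def ExList (xs : List ℕ) (φ : Fm) : Fm := xs.foldr Ex φ

/-- Finite conjunction. -/
def conj (φs : List Fm) : Fm := φs.foldr Fm.and Fm.tru

/-! Names of number variables; the names `x i` and `y i` are used for tuples. -/

abbrev k : ℕ := 0
abbrev c : ℕ := 1
abbrev j : ℕ := 2
abbrev j' : ℕ := 3
abbrev z : ℕ := 4
abbrev a : ℕ := 5
abbrev b : ℕ := 6
abbrev u : ℕ := 7
abbrev w : ℕ := 8
abbrev x (i : ℕ) : ℕ := 10 + 2 * i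
abbrev y (i : ℕ) : ℕ := 11 + 2 * i

/-! Names of set variables. -/

abbrev C : ℕ := 0
abbrev X : ℕ := 1
abbrev E : ℕ := 2
abbrev S : ℕ := 3

/-! ## Coding of tuples and functions -/

/-- `s ≤ t`. -/
def le (s t : Tm) : Fm := .lt s t ⋎ .eq s t

/-- The pairing function `(s, t) = (s + t)² + s`. -/
def pair (s t : Tm) : Tm := .add (.mul (.add s t) (.add s t)) s

/-- Codes of tuples, `(t₁, (t₂, (…, tₙ)))`. -/
def tuple : List Tm → Tm
  | [] => .zero
  | [t] => t
  | t :: s :: ts => pair t (tuple (s :: ts))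

/-- `F(t₁, …, tₙ) = v`, for a function `F` represented by its graph. -/
def app (F : ℕ) (ts : List Tm) (v : Tm) : Fm := .mem (pair (tuple ts) v) F

/-- `F` is a function with domain `{(x₁, …, xₙ) : D}` and values in `{j : R}`: it is a subset of
the product, and each tuple of the domain has exactly one value. -/
def isFunction (F : ℕ) (xs : List ℕ) (D R : Fm) : Fm :=
  All z (.mem (.var z) F ➝
    ExList xs (Ex j (D ⋏ R ⋏ .eq (.var z) (pair (tuple (xs.map .var)) (.var j))))) ⋏
  AllList xs (D ➝
    Ex j (R ⋏ app F (xs.map .var) (.var j) ⋏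
      All j' (app F (xs.map .var) (.var j') ➝ .eq (.var j') (.var j))))

/-- `x₁ < x₂ < ⋯ < xₙ`. -/
def increasing : List ℕ → Fm
  | [] => .tru
  | [_] => .tru
  | s :: t :: l => .lt (.var s) (.var t) ⋏ increasing (t :: l)

/-- The set `F` is infinite (unbounded). -/
def infinite (F : ℕ) : Fm := All a (Ex b (.lt (.var a) (.var b) ⋏ .mem (.var b) F))

/-! ## The `ℤ`-invariant Ramsey theorem -/

/-- The names `x₀, …, xₙ₋₁`. -/
def xs (n : ℕ) : List ℕ := (List.range n).map x

/-- `C` is a colouring `[ℕ]ⁿ → k`; an `n`-subset is given by its increasing enumeration. -/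
def isColouringOfSubsets (n : ℕ) : Fm :=
  isFunction C (xs n) (increasing (xs n)) (.lt (.var j) (.var k))

/-- `C(x₁, …, xₙ) = C(x₁ + z, …, xₙ + z)` for every `n`-subset and every `z`. -/
def isInvariant (n : ℕ) : Fm :=
  AllList (xs n) (All z (All j (increasing (xs n) ➝
    (app C ((xs n).map .var) (.var j) ⭤
      app C ((xs n).map fun i => .add (.var i) (.var z)) (.var j)))))

/-- `[X]ⁿ` is `C`-monochromatic. -/
def isHomogeneous (n : ℕ) : Fm :=
  Ex c (AllList (xs n) (increasing (xs n) ⋏ conj ((xs n).map fun i => .mem (.var i) X) ➝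
    app C ((xs n).map .var) (.var c)))

/-- `ℤ-RTⁿ`. -/
def ZRT (n : ℕ) : Fm :=
  AllSet C (All k (isColouringOfSubsets n ⋏ isInvariant n ➝
    ExSet X (infinite X ⋏ isHomogeneous n)))

/-! ## The adjacent Hindman theorem -/

/-- The names `y₀, …, y_{d-1}`. -/
def ys (d : ℕ) : List ℕ := (List.range d).map y

/-- `C` is a colouring `ℕᵈ → k`. -/
def isColouringOfTuples (d : ℕ) : Fm :=
  isFunction C (ys d) .tru (.lt (.var j) (.var k))

/-- `E : ℕ → ℕ` is the increasing enumeration of the set `X`. -/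
def isEnumeration : Fm :=
  isFunction E [a] .tru .tru ⋏
  All a (All b (All u (All w
    (.lt (.var a) (.var b) ⋏ app E [.var a] (.var u) ⋏ app E [.var b] (.var w) ➝
      .lt (.var u) (.var w))))) ⋏
  All u (.mem (.var u) X ⭤ Ex a (app E [.var a] (.var u)))

/-- `S(a, b) = E(a) + E(a + 1) + ⋯ + E(b)` for all `a ≤ b`. -/
def isAdjacentSums : Fm :=
  isFunction S [a, b] (le (.var a) (.var b)) .tru ⋏
  All a (All u (app S [.var a, .var a] (.var u) ⭤ app E [.var a] (.var u))) ⋏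
  All a (All b (All u (All w
    (le (.var a) (.var b) ⋏ app S [.var a, .var b] (.var u) ⋏
        app E [.add (.var b) .one] (.var w) ➝
      app S [.var a, .add (.var b) .one] (.add (.var u) (.var w))))))

/-- The index at which the `i`-th of the adjacent sums starts, in terms of the indices
`x₀ ≤ x₁ < x₂ < ⋯`: it is `x₀` for `i = 0` and `xᵢ + 1` for `i > 0`. -/
def start : ℕ → Tm
  | 0 => .var (x 0)
  | i + 1 => .add (.var (x (i + 1))) .one

/-- With the indices `x₀ ≤ x₁ < ⋯ < x_d`, the tuple `(y₀, …, y_{d-1})` is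
`(∑_{n=x₀}^{x₁} E(n), ∑_{n=x₁+1}^{x₂} E(n), …, ∑_{n=x_{d-1}+1}^{x_d} E(n))`. -/
def isAdjacentTuple (d : ℕ) : Fm :=
  le (.var (x 0)) (.var (x 1)) ⋏ increasing (xs (d + 1)).tail ⋏
  conj ((List.range d).map fun i => app S [start i, .var (x (i + 1))] (.var (y i)))

/-- `AHTᵈ`, for `d ≥ 1`. -/
def AHTd (d : ℕ) : Fm :=
  AllSet C (All k (isColouringOfTuples d ➝
    ExSet X (infinite X ⋏ ExSet E (isEnumeration ⋏ ExSet S (isAdjacentSums ⋏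
      Ex c (AllList (xs (d + 1)) (AllList (ys d) (isAdjacentTuple d ➝
        app C ((ys d).map .var) (.var c)))))))))

/-- `AHT`: the adjacent sums are `E(a) + E(a + 1) + ⋯ + E(a + b)`. -/
def AHT : Fm :=
  AllSet C (All k (isFunction C [u] .tru (.lt (.var j) (.var k)) ➝
    ExSet X (infinite X ⋏ ExSet E (isEnumeration ⋏ ExSet S (isAdjacentSums ⋏
      Ex c (All a (All b (All u
        (app S [.var a, .add (.var a) (.var b)] (.var u) ➝ app C [.var u] (.var c))))))))))

end SOA

set_option linter.unusedSectionVars false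

namespace SOA

/-! ## Substitution -/

/-! Up to translation, an increasing (d+1)-tuple is the d-tuple of its successive differences, so a
ℤ-invariant colouring of (d+1)-sets amounts to a colouring of d-tuples of positive numbers. If x_0 <
x_1 < … and y_n = x_{n+1} - x_n, the differences of members of the sequence are exactly the adjacent
sums of the y_n, and an increasing tuple gives consecutive blocks.

From Ramsey to Hindman (`IsModel.aht_of_zrt`): colour each increasing tuple by the colour of its
differences, take a homogeneous set, and thin it to a sequence that more than doubles at each step.
Then the y_n are strictly increasing and so enumerate a set. Conversely (`IsModel.zrt_of_aht`):
colour (g_0, …, g_{d-1}) by the colour of (0, g_0, g_0 + g_1, …). The set of initial sums y_0 + … +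
y_n is then homogeneous, since invariance moves each of its tuples to one that begins at 0.

Provability is reached through a Henkin completeness theorem (`completeness`, `rca0_proves`), so the
argument takes place in an arbitrary model of RCA₀. There only Σ⁰₁ induction and Δ⁰₁ comprehension
are available, so each predicate in use has to be definable; the classes `IsTerm` and `IsBounded`
leave this to instance search. The thinning is the one definition by recursion. It is supplied by
`IsModel.exists_iterate`, which rests on coding finite sets by divisibility; the adjacent sums of
the y_n are differences and need no recursion. -/

theorem Tm.subst_var (t : Tm) : t.subst .var = t := by
  induction t <;> simp_all [Tm.subst]

theorem Tm.subst_subst (σ τ : ℕ → Tm) (t : Tm) :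
    (t.subst σ).subst τ = t.subst fun i => (σ i).subst τ := by
  induction t <;> simp_all [Tm.subst]

theorem Tm.shift_subst (t : Tm) (s : Tm) (σ : ℕ → Tm) :
    t.shift.subst (consVar s σ) = t.subst σ := by
  simp [Tm.shift, Tm.subst_subst, Tm.subst, consVar]

theorem consVar_zero_succ {α : Type} (f : ℕ → α) : consVar (f 0) (fun i => f (i + 1)) = f := by
  funext i; cases i <;> rfl

theorem Fm.subst_var (φ : Fm) : φ.subst .var id = φ := by
  have h1 : (consVar (.var 0) fun i => (Tm.var i).shift) = Tm.var := by
    funext i; cases i <;> rfl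
  have h2 : (consVar 0 fun X => id X + 1) = (id : ℕ → ℕ) := by
    funext i; cases i <;> rfl
  induction φ <;> simp_all [Fm.subst, Tm.subst_var]

theorem Fm.subst_subst (φ : Fm) : ∀ (σ τ : ℕ → Tm) (ρ ν : ℕ → ℕ),
    (φ.subst σ ρ).subst τ ν = φ.subst (fun i => (σ i).subst τ) (fun i => ν (ρ i)) := by
  induction φ with
  | eq s t => intros; simp [Fm.subst, Tm.subst_subst]
  | lt s t => intros; simp [Fm.subst, Tm.subst_subst]
  | mem s t => intros; simp [Fm.subst, Tm.subst_subst]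
  | fls => intros; rfl
  | imp φ ψ h1 h2 => intros; simp [Fm.subst, h1, h2]
  | all φ h =>
    intro σ τ ρ ν
    simp only [Fm.subst, h]
    congr 2
    funext i
    cases i with
    | zero => rfl
    | succ i =>
      simp only [consVar]
      rw [Tm.shift_subst, Tm.shift, Tm.subst_subst]
      rfl
  | allSet φ h =>
    intro σ τ ρ ν
    simp only [Fm.subst, h]
    congr 2
    funext i
    cases i <;> rfl

theorem Fm.inst_subst (φ : Fm) (t : Tm) (σ : ℕ → Tm) (ρ : ℕ → ℕ) :
    (φ.inst t).subst σ ρ =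
      (φ.subst (consVar (.var 0) fun i => (σ i).shift) ρ).inst (t.subst σ) := by
  simp only [Fm.inst, Fm.subst_subst]
  congr 1
  funext i
  cases i with
  | zero => rfl
  | succ i => simp [consVar, Tm.subst, Tm.shift_subst, Tm.subst_var]

/-- The quantifier steps of the substitution rule and of the truth lemma both rest on this fusion of
two substitutions. -/
theorem Fm.lift_subst_inst (φ : Fm) (t : Tm) (σ : ℕ → Tm) (ρ : ℕ → ℕ) :
    (φ.subst (consVar (.var 0) fun i => (σ i).shift) ρ).inst t = φ.subst (consVar t σ) ρ := by
  simp only [Fm.inst, Fm.subst_subst]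
  congr 1
  funext i
  cases i with
  | zero => rfl
  | succ i => simp [consVar, Tm.shift_subst, Tm.subst_var]

theorem Fm.instSet_subst (φ : Fm) (Y : ℕ) (σ : ℕ → Tm) (ρ : ℕ → ℕ) :
    (φ.instSet Y).subst σ ρ =
      (φ.subst σ (consVar 0 fun i => ρ i + 1)).instSet (ρ Y) := by
  simp only [Fm.instSet, Fm.subst_subst, Tm.subst_var]
  congr 1
  funext i
  cases i <;> rfl

theorem Fm.lift_subst_instSet (φ : Fm) (Y : ℕ) (σ : ℕ → Tm) (ρ : ℕ → ℕ) :
    (φ.subst σ (consVar 0 fun i => ρ i + 1)).instSet Y = φ.subst σ (consVar Y ρ) := by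
  simp only [Fm.instSet, Fm.subst_subst, Tm.subst_var]
  congr 1
  funext i
  cases i <;> rfl

theorem Fm.shift_subst (φ : Fm) (σ : ℕ → Tm) (ρ : ℕ → ℕ) :
    φ.shift.subst (consVar (.var 0) fun i => (σ i).shift) ρ = (φ.subst σ ρ).shift := by
  simp only [Fm.shift, Fm.subst_subst]
  rfl

theorem Fm.shiftSet_subst (φ : Fm) (σ : ℕ → Tm) (ρ : ℕ → ℕ) :
    φ.shiftSet.subst σ (consVar 0 fun i => ρ i + 1) = (φ.subst σ ρ).shiftSet := by
  simp only [Fm.shiftSet, Fm.subst_subst, Tm.subst_var]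
  rfl

/-! ## Bounds for the free variables -/

/-- A strict upper bound for the variables of a term. -/
def Tm.numBound : Tm → ℕ
  | .var i => i + 1
  | .zero => 0
  | .one => 0
  | .add s t => max s.numBound t.numBound
  | .mul s t => max s.numBound t.numBound

/-- A strict upper bound for the free number variables of a formula. -/
def Fm.numBound : Fm → ℕ
  | .eq s t => max s.numBound t.numBound
  | .lt s t => max s.numBound t.numBound
  | .mem t _ => t.numBound
  | .fls => 0
  | .imp φ ψ => max φ.numBound ψ.numBound
  | .all φ => φ.numBound - 1
  | .allSet φ => φ.numBound

/-- A strict upper bound for the free set variables of a formula. -/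
def Fm.setBound : Fm → ℕ
  | .eq _ _ => 0
  | .lt _ _ => 0
  | .mem _ Y => Y + 1
  | .fls => 0
  | .imp φ ψ => max φ.setBound ψ.setBound
  | .all φ => φ.setBound
  | .allSet φ => φ.setBound - 1

theorem Tm.subst_congr {σ τ : ℕ → Tm} (t : Tm) (h : ∀ i < t.numBound, σ i = τ i) :
    t.subst σ = t.subst τ := by
  induction t <;> simp_all [Tm.subst, Tm.numBound]

theorem Fm.subst_congr (φ : Fm) : ∀ {σ τ : ℕ → Tm} {ρ ν : ℕ → ℕ},
    (∀ i < φ.numBound, σ i = τ i) → (∀ i < φ.setBound, ρ i = ν i) →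
      φ.subst σ ρ = φ.subst τ ν := by
  induction φ with
  | eq s t =>
    intro σ τ ρ ν h1 h2
    simp only [Fm.numBound, lt_max_iff] at h1
    simp only [Fm.subst]
    rw [s.subst_congr fun i hi => h1 i (.inl hi), t.subst_congr fun i hi => h1 i (.inr hi)]
  | lt s t =>
    intro σ τ ρ ν h1 h2
    simp only [Fm.numBound, lt_max_iff] at h1
    simp only [Fm.subst]
    rw [s.subst_congr fun i hi => h1 i (.inl hi), t.subst_congr fun i hi => h1 i (.inr hi)]
  | mem t Y =>
    intro σ τ ρ ν h1 h2
    simp only [Fm.subst]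
    rw [t.subst_congr h1, h2 Y (by simp [Fm.setBound])]
  | fls => intros; rfl
  | imp φ ψ ih1 ih2 =>
    intro σ τ ρ ν h1 h2
    simp only [Fm.numBound, Fm.setBound, lt_max_iff] at h1 h2
    simp only [Fm.subst]
    rw [ih1 (fun i hi => h1 i (.inl hi)) fun i hi => h2 i (.inl hi),
      ih2 (fun i hi => h1 i (.inr hi)) fun i hi => h2 i (.inr hi)]
  | all φ ih =>
    intro σ τ ρ ν h1 h2
    simp only [Fm.subst]
    refine congrArg _ (ih (fun i hi => ?_) h2)
    cases i with
    | zero => rfl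
    | succ i => simp only [consVar]; rw [h1 i (by simp only [Fm.numBound]; omega)]
  | allSet φ ih =>
    intro σ τ ρ ν h1 h2
    simp only [Fm.subst]
    refine congrArg _ (ih h1 fun i hi => ?_)
    cases i with
    | zero => rfl
    | succ i => simp only [consVar]; rw [h2 i (by simp only [Fm.setBound]; omega)]

/-! ## Derivations -/

theorem Derives.weaken {T : Set Fm} {Γ Δ : List Fm} {φ : Fm} (h : Derives T Γ φ) (hs : Γ ⊆ Δ) :
    Derives T Δ φ := by
  induction h generalizing Δ with
  | ax h => exact .ax h
  | hyp h => exact .hyp (hs h)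
  | impI _ ih => exact .impI (ih (List.cons_subset_cons _ hs))
  | impE _ _ ih1 ih2 => exact .impE (ih1 hs) (ih2 hs)
  | raa _ ih => exact .raa (ih (List.cons_subset_cons _ hs))
  | allI _ ih => exact .allI (ih (List.map_subset _ hs))
  | allE t _ ih => exact .allE t (ih hs)
  | allSetI _ ih => exact .allSetI (ih (List.map_subset _ hs))
  | allSetE t _ ih => exact .allSetE t (ih hs)
  | eqI t => exact .eqI t
  | eqE φ _ _ ih1 ih2 => exact .eqE φ (ih1 hs) (ih2 hs)

/-- A substitution that merely shifts from `n` on is `n` generalizations followed by `n`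
instantiations. Generalizing is unrestricted here because there are no hypotheses. -/
theorem Derives.subst_num_of_eventually {T : Set Fm} (n : ℕ) : ∀ (φ : Fm) (σ : ℕ → Tm),
    Derives T [] φ → (∀ i, σ (i + n) = .var i) → Derives T [] (φ.subst σ id) := by
  induction n with
  | zero =>
    intro φ σ h hσ
    have : σ = .var := funext hσ
    rwa [this, Fm.subst_var]
  | succ n ih =>
    intro φ σ h hσ
    have h1 := ih (.all φ) (fun i => σ (i + 1)) (.allI h) fun i => hσ i
    have h2 := h1.allE (σ 0)
    rwa [Fm.lift_subst_inst, consVar_zero_succ] at h2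

theorem Derives.subst_set_of_eventually {T : Set Fm} (n : ℕ) : ∀ (φ : Fm) (ρ : ℕ → ℕ),
    Derives T [] φ → (∀ i, ρ (i + n) = i) → Derives T [] (φ.subst .var ρ) := by
  induction n with
  | zero =>
    intro φ ρ h hρ
    have : ρ = id := funext hρ
    rwa [this, Fm.subst_var]
  | succ n ih =>
    intro φ ρ h hρ
    have h1 := ih (.allSet φ) (fun i => ρ (i + 1)) (.allSetI h) fun i => hρ i
    have h2 := h1.allSetE (ρ 0)
    rwa [Fm.lift_subst_instSet, consVar_zero_succ] at h2

/-- Only finitely many variables occur free, so beyond them any substitution may be replaced by a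
shift. -/
theorem Derives.subst_nil {T : Set Fm} {φ : Fm} (h : Derives T [] φ) (σ : ℕ → Tm) (ρ : ℕ → ℕ) :
    Derives T [] (φ.subst σ ρ) := by
  have h1 := Derives.subst_set_of_eventually φ.setBound φ
    (fun i => if i < φ.setBound then ρ i else i - φ.setBound) h (by simp)
  rw [φ.subst_congr (τ := .var) (ν := ρ) (fun _ _ => rfl) (by simp +contextual)] at h1
  have h2 := Derives.subst_num_of_eventually (φ.subst .var ρ).numBound _
    (fun i => if i < (φ.subst .var ρ).numBound then σ i
      else .var (i - (φ.subst .var ρ).numBound)) h1 (by simp)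
  rw [Fm.subst_congr _ (τ := σ) (ν := id) (by simp +contextual) (fun _ _ => rfl),
    Fm.subst_subst] at h2
  exact h2

theorem Derives.subst {T : Set Fm} {Γ : List Fm} {φ : Fm} (h : Derives T Γ φ) :
    ∀ (σ : ℕ → Tm) (ρ : ℕ → ℕ), Derives T (Γ.map (Fm.subst σ ρ)) (φ.subst σ ρ) := by
  induction h with
  -- `T` need not be closed under substitution, so an axiom is first substituted in the empty
  -- context and then weakened.
  | ax h => exact fun σ ρ => (Derives.subst_nil (.ax h) σ ρ).weaken (by simp)
  | hyp h => exact fun σ ρ => .hyp (List.mem_map_of_mem h)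
  | impI _ ih => exact fun σ ρ => .impI (ih σ ρ)
  | impE _ _ ih1 ih2 => exact fun σ ρ => .impE (ih1 σ ρ) (ih2 σ ρ)
  | raa _ ih => exact fun σ ρ => .raa (ih σ ρ)
  | allI _ ih =>
    intro σ ρ
    refine .allI ?_
    have := ih (consVar (.var 0) fun i => (σ i).shift) ρ
    simpa only [List.map_map, Function.comp_def, Fm.shift_subst] using this
  | allE t _ ih =>
    intro σ ρ
    rw [Fm.inst_subst]
    exact .allE _ (ih σ ρ)
  | allSetI _ ih =>
    intro σ ρ
    refine .allSetI ?_
    have := ih σ (consVar 0 fun i => ρ i + 1)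
    simpa only [List.map_map, Function.comp_def, Fm.shiftSet_subst] using this
  | allSetE t _ ih =>
    intro σ ρ
    rw [Fm.instSet_subst]
    exact .allSetE _ (ih σ ρ)
  | eqI t => exact fun σ ρ => .eqI _
  | eqE φ _ _ ih1 ih2 =>
    intro σ ρ
    have h2 := ih2 σ ρ
    rw [Fm.inst_subst] at h2 ⊢
    exact .eqE _ (ih1 σ ρ) h2

/-- Generalization over a variable that occurs neither in the hypotheses nor in the formula. -/
theorem Derives.all_of_fresh {T : Set Fm} {Γ : List Fm} {φ : Fm} {m : ℕ}
    (hΓ : ∀ ψ ∈ Γ, ψ.numBound ≤ m) (hφ : φ.numBound ≤ m + 1)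
    (h : Derives T Γ (φ.inst (.var m))) : Derives T Γ (.all φ) := by
  -- This renaming turns `m` into the bound index 0 and shifts the rest: it undoes the instantiation
  -- in `φ` and acts as `shift` on the hypotheses, where `m` does not occur.
  have h1 := h.subst (fun i => if i = m then .var 0 else .var (i + 1)) id
  have h2 : Γ.map (Fm.subst (fun i => if i = m then .var 0 else .var (i + 1)) id) =
      Γ.map Fm.shift := by
    refine List.map_congr_left fun ψ hψ => Fm.subst_congr _ (fun i hi => ?_) fun _ _ => rfl
    rw [if_neg (by have := hΓ ψ hψ; omega)]
  have h3 : (φ.inst (.var m)).subst (fun i => if i = m then .var 0 else .var (i + 1)) id = φ := by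
    rw [Fm.inst, Fm.subst_subst]
    conv_rhs => rw [← Fm.subst_var φ]
    refine Fm.subst_congr _ (fun i hi => ?_) fun _ _ => rfl
    cases i with
    | zero => simp [consVar, Tm.subst]
    | succ i => simp only [consVar, Tm.subst]; rw [if_neg (by omega)]
  rw [h2, h3] at h1
  exact .allI h1

theorem Derives.allSet_of_fresh {T : Set Fm} {Γ : List Fm} {φ : Fm} {m : ℕ}
    (hΓ : ∀ ψ ∈ Γ, ψ.setBound ≤ m) (hφ : φ.setBound ≤ m + 1)
    (h : Derives T Γ (φ.instSet m)) : Derives T Γ (.allSet φ) := by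
  have h1 := h.subst .var (fun i => if i = m then 0 else i + 1)
  have h2 : Γ.map (Fm.subst .var (fun i => if i = m then 0 else i + 1)) =
      Γ.map Fm.shiftSet := by
    refine List.map_congr_left fun ψ hψ => Fm.subst_congr _ (fun _ _ => rfl) fun i hi => ?_
    rw [if_neg (by have := hΓ ψ hψ; omega)]
  have h3 : (φ.instSet m).subst .var (fun i => if i = m then 0 else i + 1) = φ := by
    rw [Fm.instSet, Fm.subst_subst]
    conv_rhs => rw [← Fm.subst_var φ]
    refine Fm.subst_congr _ (fun _ _ => rfl) fun i hi => ?_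
    cases i with
    | zero => simp [consVar]
    | succ i => exact if_neg (show i ≠ m by omega)
  rw [h2, h3] at h1
  exact .allSetI h1

theorem Derives.fls_elim {T : Set Fm} {Γ : List Fm} {φ : Fm} (h : Derives T Γ .fls) :
    Derives T Γ φ := .raa (h.weaken (List.subset_cons_self _ _))

/-! ## Completeness -/

/-- A numerical code of a term. -/
def Tm.code : Tm → ℕ
  | .var i => Nat.pair 0 i
  | .zero => Nat.pair 1 0
  | .one => Nat.pair 2 0
  | .add s t => Nat.pair 3 (Nat.pair s.code t.code)
  | .mul s t => Nat.pair 4 (Nat.pair s.code t.code)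

theorem Tm.code_injective : ∀ s t : Tm, s.code = t.code → s = t := by
  intro s
  induction s with
  | var => intro t; cases t <;> simp [Tm.code, Nat.pair_eq_pair]
  | zero => intro t; cases t <;> simp [Tm.code, Nat.pair_eq_pair]
  | one => intro t; cases t <;> simp [Tm.code, Nat.pair_eq_pair]
  | add s t h1 h2 =>
    intro t; cases t <;> simp [Tm.code, Nat.pair_eq_pair]
    exact fun a b => ⟨h1 _ a, h2 _ b⟩
  | mul s t h1 h2 =>
    intro t; cases t <;> simp [Tm.code, Nat.pair_eq_pair]
    exact fun a b => ⟨h1 _ a, h2 _ b⟩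

/-- A numerical code of a formula. -/
def Fm.code : Fm → ℕ
  | .eq s t => Nat.pair 0 (Nat.pair s.code t.code)
  | .lt s t => Nat.pair 1 (Nat.pair s.code t.code)
  | .mem t Y => Nat.pair 2 (Nat.pair t.code Y)
  | .fls => Nat.pair 3 0
  | .imp φ ψ => Nat.pair 4 (Nat.pair φ.code ψ.code)
  | .all φ => Nat.pair 5 φ.code
  | .allSet φ => Nat.pair 6 φ.code

theorem Fm.code_injective : ∀ φ ψ : Fm, φ.code = ψ.code → φ = ψ := by
  intro φ
  induction φ with
  | eq s t =>
    intro ψ; cases ψ <;> simp [Fm.code, Nat.pair_eq_pair]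
    exact fun a b => ⟨Tm.code_injective _ _ a, Tm.code_injective _ _ b⟩
  | lt s t =>
    intro ψ; cases ψ <;> simp [Fm.code, Nat.pair_eq_pair]
    exact fun a b => ⟨Tm.code_injective _ _ a, Tm.code_injective _ _ b⟩
  | mem s t =>
    intro ψ; cases ψ <;> simp [Fm.code, Nat.pair_eq_pair]
    exact fun a b => ⟨Tm.code_injective _ _ a, b⟩
  | fls => intro ψ; cases ψ <;> simp [Fm.code, Nat.pair_eq_pair]
  | imp φ ψ h1 h2 =>
    intro ψ; cases ψ <;> simp [Fm.code, Nat.pair_eq_pair]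
    exact fun a b => ⟨h1 _ a, h2 _ b⟩
  | all φ h =>
    intro ψ; cases ψ <;> simp [Fm.code, Nat.pair_eq_pair]
    exact h _
  | allSet φ h =>
    intro ψ; cases ψ <;> simp [Fm.code, Nat.pair_eq_pair]
    exact h _

instance : Countable Fm := (show Function.Injective Fm.code from Fm.code_injective).countable

instance : Nonempty Fm := ⟨.fls⟩

/-- No contradiction is derivable from `T` and the hypotheses `Γ`. -/
def Consistent (T : Set Fm) (Γ : List Fm) : Prop := ¬ Derives T Γ .fls

theorem exists_bound (f : Fm → ℕ) (Γ : List Fm) : ∃ m, ∀ ψ ∈ Γ, f ψ ≤ m := by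
  induction Γ with
  | nil => exact ⟨0, by simp⟩
  | cons φ Γ ih =>
    obtain ⟨m, hm⟩ := ih
    refine ⟨max (f φ) m, fun ψ hψ => ?_⟩
    rcases List.mem_cons.1 hψ with rfl | h
    · exact le_max_left _ _
    · exact (hm ψ h).trans (le_max_right _ _)

theorem Consistent.decide {T : Set Fm} {Γ : List Fm} (h : Consistent T Γ) (ψ : Fm) :
    Consistent T (ψ :: Γ) ∨ Consistent T (ψ.neg :: Γ) := by
  by_contra hc
  rw [not_or, Consistent, Consistent, not_not, not_not] at hc
  exact h (.impE (.impI hc.1) (.raa hc.2))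

/-- One step in the construction of a maximal consistent set with witnesses. -/
theorem Consistent.extend {T : Set Fm} {Γ : List Fm} (h : Consistent T Γ) (ψ : Fm) :
    ∃ Δ : List Fm, Consistent T Δ ∧ Γ ⊆ Δ ∧ (ψ ∈ Δ ∨ ψ.neg ∈ Δ ∧
      (∀ θ, ψ = .all θ → ∃ t, (θ.inst t).neg ∈ Δ) ∧
      (∀ θ, ψ = .allSet θ → ∃ Y, (θ.instSet Y).neg ∈ Δ)) := by
  rcases h.decide ψ with h1 | h1
  · exact ⟨_, h1, by simp, .inl (by simp)⟩
  by_cases hall : ∃ θ, ψ = .all θ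
  · obtain ⟨θ, rfl⟩ := hall
    -- A variable beyond all hypotheses is the Henkin witness: were ¬θ(m) inconsistent with them,
    -- generalizing over `m` would derive the universal formula.
    obtain ⟨m, hm⟩ := exists_bound Fm.numBound (.all θ :: Fm.neg (.all θ) :: Γ)
    refine ⟨(θ.inst (.var m)).neg :: Fm.neg (.all θ) :: Γ, fun hd => h1 ?_,
      fun _ h => by simp [h], .inr ⟨by simp, fun θ' h => ?_, by simp⟩⟩
    · refine .impE (.hyp (List.mem_cons_self ..)) (Derives.all_of_fresh (m := m)
        (fun ψ hψ => hm ψ (List.mem_cons_of_mem _ hψ)) ?_ (.raa hd))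
      have := hm (.all θ) (List.mem_cons_self ..)
      simp only [Fm.numBound] at this
      omega
    · cases h; exact ⟨.var m, by simp⟩
  by_cases hallSet : ∃ θ, ψ = .allSet θ
  · obtain ⟨θ, rfl⟩ := hallSet
    obtain ⟨m, hm⟩ := exists_bound Fm.setBound (.allSet θ :: Fm.neg (.allSet θ) :: Γ)
    refine ⟨(θ.instSet m).neg :: Fm.neg (.allSet θ) :: Γ, fun hd => h1 ?_,
      fun _ h => by simp [h], .inr ⟨by simp, by simp, fun θ' h => ?_⟩⟩
    · refine .impE (.hyp (List.mem_cons_self ..)) (Derives.allSet_of_fresh (m := m)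
        (fun ψ hψ => hm ψ (List.mem_cons_of_mem _ hψ)) ?_ (.raa hd))
      have := hm (.allSet θ) (List.mem_cons_self ..)
      simp only [Fm.setBound] at this
      omega
    · cases h; exact ⟨m, by simp⟩
  exact ⟨_, h1, by simp, .inr ⟨by simp, fun θ h => (hall ⟨θ, h⟩).elim,
    fun θ h => (hallSet ⟨θ, h⟩).elim⟩⟩

/-- A deductively closed, complete set of formulas with witnesses for the false universal
formulas. -/
structure HenkinSet (T : Set Fm) (Δ : Set Fm) : Prop where
  closed : ∀ Γ : List Fm, (∀ ψ ∈ Γ, ψ ∈ Δ) → ∀ φ, Derives T Γ φ → φ ∈ Δ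
  consistent : .fls ∉ Δ
  total : ∀ φ : Fm, φ ∉ Δ → φ.neg ∈ Δ
  witness : ∀ θ : Fm, .all θ ∉ Δ → ∃ t, θ.inst t ∉ Δ
  witnessSet : ∀ θ : Fm, .allSet θ ∉ Δ → ∃ Y, θ.instSet Y ∉ Δ

/-- Lindenbaum's construction with witnesses: treat the formulas one by one along an enumeration and
take the union. Any finite set of hypotheses already lies in one stage, so consistency passes to the
union. -/
theorem Consistent.exists_henkinSet {T : Set Fm} {Γ : List Fm} (h : Consistent T Γ) :
    ∃ Δ, HenkinSet T Δ ∧ ∀ ψ ∈ Γ, ψ ∈ Δ := by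
  obtain ⟨g, hg⟩ := exists_surjective_nat Fm
  choose! F hF1 hF2 hF3 using fun (Γ : List Fm) (ψ : Fm) (h : Consistent T Γ) => h.extend ψ
  let G : ℕ → List Fm := fun n => Nat.rec Γ (fun n Γ' => F Γ' (g n)) n
  have hG0 : G 0 = Γ := rfl
  have hGs : ∀ n, G (n + 1) = F (G n) (g n) := fun n => rfl
  have hcons : ∀ n, Consistent T (G n) := by
    intro n
    induction n with
    | zero => exact h
    | succ n ih => rw [hGs]; exact hF1 _ _ ih
  have hmono : ∀ {m n}, m ≤ n → G m ⊆ G n := by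
    intro m n hmn
    induction hmn with
    | refl => exact fun _ h => h
    | step _ ih => exact List.Subset.trans ih (by rw [hGs]; exact hF2 _ _ (hcons _))
  have hfin : ∀ Γ' : List Fm, (∀ ψ ∈ Γ', ∃ n, ψ ∈ G n) → ∃ n, Γ' ⊆ G n := by
    intro Γ'
    induction Γ' with
    | nil => exact fun _ => ⟨0, by simp⟩
    | cons ψ Γ' ih =>
      intro hh
      obtain ⟨n, hn⟩ := ih fun ψ hψ => hh ψ (List.mem_cons_of_mem _ hψ)
      obtain ⟨m, hm⟩ := hh ψ (List.mem_cons_self ..)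
      exact ⟨max m n, List.cons_subset.2 ⟨hmono (le_max_left _ _) hm,
        List.Subset.trans hn (hmono (le_max_right _ _))⟩⟩
  have hneg : ∀ φ, (∃ n, φ ∈ G n) → (∃ n, φ.neg ∈ G n) → False := by
    intro φ h1 h2
    obtain ⟨n, hn⟩ := hfin [φ, φ.neg] (by simp [h1, h2])
    exact hcons n (.impE (.hyp (hn (a := φ.neg) (by simp))) (.hyp (hn (a := φ) (by simp))))
  have hstep : ∀ φ, (¬ ∃ n, φ ∈ G n) → ∃ n, φ.neg ∈ G n ∧
      (∀ θ, φ = .all θ → ∃ t, (θ.inst t).neg ∈ G n) ∧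
      (∀ θ, φ = .allSet θ → ∃ Y, (θ.instSet Y).neg ∈ G n) := by
    intro φ hφ
    obtain ⟨n, rfl⟩ := hg φ
    rcases hF3 (G n) (g n) (hcons n) with h' | h'
    · exact absurd ⟨n + 1, h'⟩ hφ
    · exact ⟨n + 1, h'⟩
  refine ⟨{φ | ∃ n, φ ∈ G n}, ⟨?_, ?_, ?_, ?_, ?_⟩, fun ψ hψ => ⟨0, hψ⟩⟩
  · intro Γ' h1 φ h2
    refine Classical.byContradiction fun hφ => ?_
    obtain ⟨n, hn⟩ := hfin Γ' h1
    obtain ⟨m, hm, -⟩ := hstep φ hφ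
    exact hcons (max n m) (.impE (.hyp (hmono (le_max_right _ _) hm))
      (h2.weaken (List.Subset.trans hn (hmono (le_max_left _ _)))))
  · rintro ⟨n, hn⟩
    exact hcons n (.hyp hn)
  · intro φ hφ
    obtain ⟨m, hm, -⟩ := hstep φ hφ
    exact ⟨m, hm⟩
  · intro θ hθ
    obtain ⟨m, -, hm, -⟩ := hstep _ hθ
    obtain ⟨t, ht⟩ := hm θ rfl
    exact ⟨t, fun h' => hneg _ h' ⟨m, ht⟩⟩
  · intro θ hθ
    obtain ⟨m, -, -, hm⟩ := hstep _ hθ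
    obtain ⟨t, ht⟩ := hm θ rfl
    exact ⟨t, fun h' => hneg _ h' ⟨m, ht⟩⟩

/-! ### Tarski semantics and the term model -/

section Semantics

variable {M V : Type} [Zero M] [One M] [Add M] [Mul M] [LT M] [Membership M V]

/-- The value of a term. -/
def Tm.eval (e : ℕ → M) : Tm → M
  | .var i => e i
  | .zero => 0
  | .one => 1
  | .add s t => s.eval e + t.eval e
  | .mul s t => s.eval e * t.eval e

/-- Satisfaction of a formula, in a structure with number sort `M` and set sort `V`. -/
def Fm.Sat : (ℕ → M) → (ℕ → V) → Fm → Prop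
  | e, _, .eq s t => s.eval e = t.eval e
  | e, _, .lt s t => s.eval e < t.eval e
  | e, r, .mem t Y => t.eval e ∈ r Y
  | _, _, .fls => False
  | e, r, .imp φ ψ => φ.Sat e r → ψ.Sat e r
  | e, r, .all φ => ∀ m, φ.Sat (consVar m e) r
  | e, r, .allSet φ => ∀ A, φ.Sat e (consVar A r)

end Semantics

namespace HenkinSet

variable {T Δ : Set Fm}

theorem imp_iff (h : HenkinSet T Δ) {φ ψ : Fm} : (φ ➝ ψ) ∈ Δ ↔ (φ ∈ Δ → ψ ∈ Δ) := by
  constructor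
  · exact fun h1 h2 => h.closed [φ ➝ ψ, φ] (by simp [h1, h2]) _
      (.impE (.hyp (φ := φ ➝ ψ) (by simp)) (.hyp (by simp)))
  · intro h1
    by_cases h2 : φ ∈ Δ
    · exact h.closed [ψ] (by simp [h1 h2]) _ (.impI (.hyp (by simp)))
    · exact h.closed [φ.neg] (by simp [h.total φ h2]) _
        (.impI (.fls_elim (.impE (.hyp (φ := φ.neg) (by simp)) (.hyp (by simp)))))

theorem all_iff (h : HenkinSet T Δ) {φ : Fm} : .all φ ∈ Δ ↔ ∀ t, φ.inst t ∈ Δ := by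
  constructor
  · exact fun h1 t => h.closed [.all φ] (by simp [h1]) _ (.allE t (.hyp (by simp)))
  · intro h1
    by_contra h2
    obtain ⟨t, ht⟩ := h.witness φ h2
    exact ht (h1 t)

theorem allSet_iff (h : HenkinSet T Δ) {φ : Fm} : .allSet φ ∈ Δ ↔ ∀ Y, φ.instSet Y ∈ Δ := by
  constructor
  · exact fun h1 t => h.closed [.allSet φ] (by simp [h1]) _ (.allSetE t (.hyp (by simp)))
  · intro h1
    by_contra h2
    obtain ⟨t, ht⟩ := h.witnessSet φ h2
    exact ht (h1 t)

theorem eq_subst (h : HenkinSet T Δ) {s t : Tm} (φ : Fm) (h1 : .eq s t ∈ Δ)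
    (h2 : φ.inst s ∈ Δ) : φ.inst t ∈ Δ :=
  h.closed [.eq s t, φ.inst s] (by simp [h1, h2]) _
    (.eqE (s := s) φ (.hyp (by simp)) (.hyp (by simp)))

theorem eq_refl (h : HenkinSet T Δ) (t : Tm) : .eq t t ∈ Δ := h.closed [] (by simp) _ (.eqI t)

theorem eq_symm (h : HenkinSet T Δ) {s t : Tm} (h1 : .eq s t ∈ Δ) : .eq t s ∈ Δ := by
  have := h.eq_subst (.eq (.var 0) s.shift) h1
  simp only [Fm.inst, Fm.subst, Tm.shift_subst, Tm.subst_var] at this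
  exact this (h.eq_refl s)

/-- Formulas with two equal terms plugged in are equivalent. -/
theorem congr₂ (h : HenkinSet T Δ) {s s' t t' : Tm} (R : Tm → Tm → Fm)
    (hR : ∀ s t σ, (R s t).subst σ id = R (s.subst σ) (t.subst σ))
    (hs : .eq s s' ∈ Δ) (ht : .eq t t' ∈ Δ) (h1 : R s t ∈ Δ) : R s' t' ∈ Δ := by
  -- One argument is replaced at a time: `var 0` marks its place, and the other argument is shifted
  -- so that instantiation leaves it alone.
  have h2 := h.eq_subst (R (.var 0) t.shift) hs
  simp only [Fm.inst, hR, Tm.shift_subst, Tm.subst_var, Tm.subst, consVar] at h2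
  have h3 := h.eq_subst (R s'.shift (.var 0)) ht
  simp only [Fm.inst, hR, Tm.shift_subst, Tm.subst_var, Tm.subst, consVar] at h3
  exact h3 (h2 h1)

theorem eq_trans (h : HenkinSet T Δ) {r s t : Tm} (h1 : .eq r s ∈ Δ) (h2 : .eq s t ∈ Δ) :
    .eq r t ∈ Δ :=
  h.congr₂ .eq (fun _ _ _ => rfl) (h.eq_refl r) h2 h1

/-- Provable equality of terms. -/
def setoid (h : HenkinSet T Δ) : Setoid Tm where
  r s t := .eq s t ∈ Δ
  iseqv := ⟨h.eq_refl, h.eq_symm, h.eq_trans⟩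

theorem op_congr (h : HenkinSet T Δ) {s s' t t' : Tm} (f : Tm → Tm → Tm)
    (hf : ∀ s t σ, (f s t).subst σ = f (s.subst σ) (t.subst σ))
    (hs : .eq s s' ∈ Δ) (ht : .eq t t' ∈ Δ) : .eq (f s t) (f s' t') ∈ Δ := by
  have h2 := h.eq_subst (.eq (f s.shift t.shift) (f (.var 0) t.shift)) hs
  simp only [Fm.inst, Fm.subst, hf, Tm.shift_subst, Tm.subst_var, Tm.subst, consVar] at h2
  have h3 := h.eq_subst (.eq (f s.shift t.shift) (f s'.shift (.var 0))) ht
  simp only [Fm.inst, Fm.subst, hf, Tm.shift_subst, Tm.subst_var, Tm.subst, consVar] at h3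
  exact h3 (h2 (h.eq_refl _))

end HenkinSet

/-- A formula that holds in all models of `T` is provable from `T`. -/
theorem completeness {T : Set Fm} {φ : Fm}
    (h : ∀ (M V : Type) [Zero M] [One M] [Add M] [Mul M] [LT M] [Membership M V],
      (∀ ψ ∈ T, ∀ (e : ℕ → M) (r : ℕ → V), ψ.Sat e r) →
        ∀ (e : ℕ → M) (r : ℕ → V), φ.Sat e r) : Proves T φ := by
  by_contra hφ
  have hc : Consistent T [φ.neg] := fun hd => hφ (.raa hd)
  obtain ⟨Δ, hΔ, hΓ⟩ := hc.exists_henkinSet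
  let M := Quotient hΔ.setoid
  let _ : Zero M := ⟨Quotient.mk _ .zero⟩
  let _ : One M := ⟨Quotient.mk _ .one⟩
  let _ : Add M := ⟨Quotient.map₂ .add fun _ _ h1 _ _ h2 =>
    hΔ.op_congr .add (fun _ _ _ => rfl) h1 h2⟩
  let _ : Mul M := ⟨Quotient.map₂ .mul fun _ _ h1 _ _ h2 =>
    hΔ.op_congr .mul (fun _ _ _ => rfl) h1 h2⟩
  let _ : LT M := ⟨Quotient.lift₂ (fun s t => .lt s t ∈ Δ) fun _ _ _ _ h1 h2 => propext
    ⟨hΔ.congr₂ .lt (fun _ _ _ => rfl) h1 h2,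
      hΔ.congr₂ .lt (fun _ _ _ => rfl) (hΔ.eq_symm h1) (hΔ.eq_symm h2)⟩⟩
  -- The set sort consists of the set variables themselves; without equality between sets in the
  -- language no quotient is needed.
  let _ : Membership M ℕ := ⟨fun Y => Quotient.lift (fun s => .mem s Y ∈ Δ) fun _ _ h1 => propext
    ⟨hΔ.congr₂ (fun s _ => .mem s Y) (fun _ _ _ => rfl) h1 h1,
      hΔ.congr₂ (fun s _ => .mem s Y) (fun _ _ _ => rfl) (hΔ.eq_symm h1) (hΔ.eq_symm h1)⟩⟩
  have hev : ∀ (t : Tm) (σ : ℕ → Tm),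
      t.eval (fun i => (Quotient.mk _ (σ i) : M)) = Quotient.mk _ (t.subst σ) := by
    intro t σ
    induction t with
    | var i => rfl
    | zero => rfl
    | one => rfl
    | add s t h1 h2 => simp only [Tm.eval, h1, h2, Tm.subst]; rfl
    | mul s t h1 h2 => simp only [Tm.eval, h1, h2, Tm.subst]; rfl
  -- The truth lemma is stated for all substitutions, since a quantifier step replaces the
  -- environment by one headed by the class of an arbitrary term.
  have truth : ∀ (ψ : Fm) (σ : ℕ → Tm) (ρ : ℕ → ℕ),
      ψ.Sat (fun i => (Quotient.mk _ (σ i) : M)) ρ ↔ ψ.subst σ ρ ∈ Δ := by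
    intro ψ
    induction ψ with
    | eq s t => intro σ ρ; simp only [Fm.Sat, hev, Fm.subst]; exact Quotient.eq
    | lt s t => intro σ ρ; simp only [Fm.Sat, hev, Fm.subst]; exact Iff.rfl
    | mem t Y => intro σ ρ; simp only [Fm.Sat, hev, Fm.subst]; exact Iff.rfl
    | fls => intro σ ρ; simp only [Fm.Sat, Fm.subst, hΔ.consistent]
    | imp φ ψ h1 h2 => intro σ ρ; simp only [Fm.Sat, Fm.subst, h1, h2, hΔ.imp_iff]
    | all ψ ih =>
      intro σ ρ
      simp only [Fm.Sat, Fm.subst, hΔ.all_iff, Fm.lift_subst_inst, ← ih]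
      have hcons : ∀ t : Tm, consVar (Quotient.mk _ t : M) (fun i => Quotient.mk _ (σ i)) =
          fun i => Quotient.mk _ (consVar t σ i) := by
        intro t; funext i; cases i <;> rfl
      constructor
      · intro hh t; rw [← hcons]; exact hh _
      · intro hh m
        obtain ⟨t, rfl⟩ := Quotient.exists_rep m
        rw [hcons]; exact hh t
    | allSet ψ ih =>
      intro σ ρ
      simp only [Fm.Sat, Fm.subst, hΔ.allSet_iff, Fm.lift_subst_instSet, ← ih]
  have hT : ∀ ψ ∈ T, ∀ (e : ℕ → M) (r : ℕ → ℕ), ψ.Sat e r := by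
    intro ψ hψ e r
    -- Every environment comes from a substitution, by choosing representatives.
    have he : e = fun i => Quotient.mk _ ((e i).out) := by funext i; exact (Quotient.out_eq _).symm
    rw [he, truth]
    exact hΔ.closed [] (by simp) _ (Derives.subst_nil (.ax hψ) _ _)
  have h1 := (truth φ .var id).1 (h M ℕ hT _ _)
  have h2 := hΓ φ.neg (by simp)
  rw [Fm.subst_var] at h1
  exact hΔ.consistent (hΔ.imp_iff.1 h2 h1)

/-! ### Satisfaction under substitution and for the defined connectives -/

section Satisfaction

variable {M V : Type} [Zero M] [One M] [Add M] [Mul M]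

theorem Tm.eval_subst (t : Tm) (σ : ℕ → Tm) (e : ℕ → M) :
    (t.subst σ).eval e = t.eval fun i => (σ i).eval e := by
  induction t <;> simp_all [Tm.subst, Tm.eval]

theorem Tm.eval_shift (t : Tm) (m : M) (e : ℕ → M) : t.shift.eval (consVar m e) = t.eval e := by
  rw [Tm.shift, Tm.eval_subst]; rfl

variable [LT M] [Membership M V]

theorem Fm.sat_subst (φ : Fm) : ∀ (σ : ℕ → Tm) (ρ : ℕ → ℕ) (e : ℕ → M) (r : ℕ → V),
    (φ.subst σ ρ).Sat e r ↔ φ.Sat (fun i => (σ i).eval e) fun i => r (ρ i) := by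
  induction φ with
  | eq s t => intros; simp [Fm.subst, Fm.Sat, Tm.eval_subst]
  | lt s t => intros; simp [Fm.subst, Fm.Sat, Tm.eval_subst]
  | mem s t => intros; simp [Fm.subst, Fm.Sat, Tm.eval_subst]
  | fls => intros; rfl
  | imp φ ψ h1 h2 => intros; simp [Fm.subst, Fm.Sat, h1, h2]
  | all φ h =>
    intro σ ρ e r
    simp only [Fm.subst, Fm.Sat, h]
    refine forall_congr' fun m => ?_
    have : (fun i => (consVar (.var 0) (fun i => (σ i).shift) i : Tm).eval (consVar m e)) =
        consVar m fun i => (σ i).eval e := by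
      funext i
      cases i with
      | zero => rfl
      | succ i => exact Tm.eval_shift ..
    rw [this]
  | allSet φ h =>
    intro σ ρ e r
    simp only [Fm.subst, Fm.Sat, h]
    refine forall_congr' fun A => ?_
    have : (fun i => (consVar A r : ℕ → V) ((consVar 0 fun X => ρ X + 1 : ℕ → ℕ) i)) =
        consVar A fun i => r (ρ i) := by
      funext i
      cases i <;> rfl
    rw [this]

variable (e : ℕ → M) (r : ℕ → V) (φ ψ : Fm)

theorem Fm.sat_imp : (φ ➝ ψ).Sat e r ↔ (φ.Sat e r → ψ.Sat e r) := Iff.rfl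

theorem Fm.sat_neg : φ.neg.Sat e r ↔ ¬ φ.Sat e r := Iff.rfl

theorem Fm.sat_tru : Fm.tru.Sat e r ↔ True := by simp [Fm.tru, Fm.neg, Fm.Sat]

theorem Fm.sat_and : (φ ⋏ ψ).Sat e r ↔ φ.Sat e r ∧ ψ.Sat e r := by
  simp [Fm.and, Fm.neg, Fm.Sat]

theorem Fm.sat_or : (φ ⋎ ψ).Sat e r ↔ φ.Sat e r ∨ ψ.Sat e r := by
  simp only [Fm.or, Fm.neg, Fm.Sat]; tauto

theorem Fm.sat_iff : (φ ⭤ ψ).Sat e r ↔ (φ.Sat e r ↔ ψ.Sat e r) := by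
  simp only [Fm.iff, Fm.sat_and, Fm.Sat]; tauto

theorem Fm.sat_ex : φ.ex.Sat e r ↔ ∃ m, φ.Sat (consVar m e) r := by
  simp [Fm.ex, Fm.neg, Fm.Sat]

theorem Fm.sat_exSet : φ.exSet.Sat e r ↔ ∃ A, φ.Sat e (consVar A r) := by
  simp [Fm.exSet, Fm.neg, Fm.Sat]

end Satisfaction

theorem Fm.Bounded.subst {φ : Fm} (h : φ.Bounded) :
    ∀ (σ : ℕ → Tm) (ρ : ℕ → ℕ), (φ.subst σ ρ).Bounded := by
  have key : ∀ (t : Tm) (σ : ℕ → Tm),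
      t.shift.subst (consVar (.var 0) fun i => (σ i).shift) = (t.subst σ).shift := by
    intro t σ
    rw [Tm.shift_subst, Tm.shift, Tm.subst_subst]; rfl
  induction h with
  | eq s t => exact fun σ ρ => .eq _ _
  | lt s t => exact fun σ ρ => .lt _ _
  | mem t Y => exact fun σ ρ => .mem _ _
  | fls => exact fun σ ρ => .fls
  | imp _ _ h1 h2 => exact fun σ ρ => .imp (h1 σ ρ) (h2 σ ρ)
  | ball t _ h1 =>
    intro σ ρ
    simp only [Fm.subst, key]
    exact .ball _ (h1 _ _)
  | bex t _ h1 =>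
    intro σ ρ
    simp only [Fm.ex, Fm.neg, Fm.and, Fm.subst, key]
    exact .bex _ (h1 _ _)

/-! ## Predicates definable by bounded formulas with parameters -/

/-- The sequence with `e` at the even and `p` at the odd places. -/
def interleave {α : Type} (e p : ℕ → α) (i : ℕ) : α := if i % 2 = 0 then e (i / 2) else p (i / 2)

@[simp] theorem interleave_even {α : Type} (e p : ℕ → α) (i : ℕ) :
    interleave e p (2 * i) = e i := by
  simp [interleave]

@[simp] theorem interleave_odd {α : Type} (e p : ℕ → α) (i : ℕ) :
    interleave e p (2 * i + 1) = p i := by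
  simp only [interleave]
  rw [if_neg (by omega)]; congr 1; omega

@[elab_as_elim]
theorem even_or_odd_cases {motive : ℕ → Prop} (i : ℕ) (h0 : ∀ i, motive (2 * i))
    (h1 : ∀ i, motive (2 * i + 1)) : motive i := by
  obtain ⟨m, rfl | rfl⟩ := Nat.even_or_odd' i
  · exact h0 m
  · exact h1 m

/-- Renaming that moves the parameters to the places given by `f`. -/
def moveParams (f : ℕ → ℕ) : ℕ → ℕ := interleave (2 * ·) (fun i => 2 * f i + 1)

theorem interleave_moveParams {M : Type} {e p q : ℕ → M} {f : ℕ → ℕ} (h : ∀ i, q (f i) = p i) (i : ℕ) :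
    interleave e q (moveParams f i) = interleave e p i := by
  refine even_or_odd_cases i (fun i => ?_) (fun i => ?_) <;> simp [moveParams, h]

section Definability

variable {M : Type} [Zero M] [One M] [Add M] [Mul M]

/-- Functions given by a term with parameters. -/
class IsTerm (t : (ℕ → M) → M) : Prop where
  out : ∃ (s : Tm) (p : ℕ → M), ∀ e, s.eval (interleave e p) = t e

/-- Arguments sit at even and parameters at odd places, so parameters can be reindexed without
touching arguments. Two definitions can thus be brought to a common list of parameters. -/
theorem IsTerm.move {t : (ℕ → M) → M} {s : Tm} {p q : ℕ → M} (f : ℕ → ℕ)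
    (h : ∀ e, s.eval (interleave e p) = t e) (hf : ∀ i, q (f i) = p i) :
    ∃ s' : Tm, ∀ e, s'.eval (interleave e q) = t e :=
  ⟨s.subst fun i => .var (moveParams f i), fun e => by
    simp only [Tm.eval_subst, Tm.eval, interleave_moveParams hf, h]⟩

theorem IsTerm.common {t t' : (ℕ → M) → M} (h : IsTerm t) (h' : IsTerm t') :
    ∃ (s s' : Tm) (p : ℕ → M), (∀ e, s.eval (interleave e p) = t e) ∧
      ∀ e, s'.eval (interleave e p) = t' e := by
  obtain ⟨s, p, hs⟩ := h
  obtain ⟨s', p', hs'⟩ := h'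
  obtain ⟨u, hu⟩ := IsTerm.move (q := interleave p p') (2 * ·) hs (by simp)
  obtain ⟨u', hu'⟩ := IsTerm.move (q := interleave p p') (2 * · + 1) hs' (by simp)
  exact ⟨u, u', _, hu, hu'⟩

instance IsTerm.var (i : ℕ) : IsTerm fun e : ℕ → M => e i :=
  ⟨.var (2 * i), e₀, fun e => interleave_even e e₀ i⟩
where e₀ : ℕ → M := fun _ => 0

instance IsTerm.const (m : M) : IsTerm fun _ => m :=
  ⟨.var (2 * 0 + 1), fun _ => m, fun e => interleave_odd e _ 0⟩

instance IsTerm.add {s t : (ℕ → M) → M} [hs : IsTerm s] [ht : IsTerm t] :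
    IsTerm fun e => s e + t e := by
  obtain ⟨u, v, p, h1, h2⟩ := hs.common ht
  exact ⟨.add u v, p, fun e => by simp [Tm.eval, h1, h2]⟩

instance IsTerm.mul {s t : (ℕ → M) → M} [hs : IsTerm s] [ht : IsTerm t] :
    IsTerm fun e => s e * t e := by
  obtain ⟨u, v, p, h1, h2⟩ := hs.common ht
  exact ⟨.mul u v, p, fun e => by simp [Tm.eval, h1, h2]⟩

theorem IsTerm.rename {t : (ℕ → M) → M} (h : IsTerm t) (f : ℕ → ℕ) :
    IsTerm fun e => t fun i => e (f i) := by
  obtain ⟨s, p, h⟩ := h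
  refine ⟨s.subst (interleave (fun i => .var (2 * f i)) fun i => .var (2 * i + 1)), p, fun e => ?_⟩
  rw [← h, Tm.eval_subst]
  congr 1
  funext i
  refine even_or_odd_cases i (fun i => ?_) (fun i => ?_) <;> simp [Tm.eval]

variable (V : Type) [LT M] [Membership M V]

/-- Predicates given by a bounded formula with parameters. -/
class IsBounded (P : (ℕ → M) → Prop) : Prop where
  out : ∃ (φ : Fm) (p : ℕ → M) (r : ℕ → V), φ.Bounded ∧ ∀ e, φ.Sat (interleave e p) r ↔ P e

variable {V}

theorem IsBounded.congr {P Q : (ℕ → M) → Prop} (h : IsBounded V P) (hPQ : ∀ e, P e ↔ Q e) :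
    IsBounded V Q := by
  have : P = Q := funext fun e => propext (hPQ e)
  rwa [← this]

theorem IsBounded.move {P : (ℕ → M) → Prop} {φ : Fm} {p q : ℕ → M} {r w : ℕ → V} (f g : ℕ → ℕ)
    (hφ : φ.Bounded) (h : ∀ e, φ.Sat (interleave e p) r ↔ P e) (hf : ∀ i, q (f i) = p i)
    (hg : ∀ i, w (g i) = r i) :
    ∃ φ' : Fm, φ'.Bounded ∧ ∀ e, φ'.Sat (interleave e q) w ↔ P e :=
  ⟨φ.subst (fun i => .var (moveParams f i)) g, hφ.subst _ _, fun e => by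
    simp only [Fm.sat_subst, Tm.eval, interleave_moveParams hf, hg, h]⟩

theorem IsBounded.common {P Q : (ℕ → M) → Prop} (h : IsBounded V P) (h' : IsBounded V Q) :
    ∃ (φ ψ : Fm) (p : ℕ → M) (r : ℕ → V), φ.Bounded ∧ ψ.Bounded ∧
      (∀ e, φ.Sat (interleave e p) r ↔ P e) ∧ ∀ e, ψ.Sat (interleave e p) r ↔ Q e := by
  obtain ⟨s, p, r, hb, hs⟩ := h
  obtain ⟨s', p', r', hb', hs'⟩ := h'
  obtain ⟨u, hbu, hu⟩ := IsBounded.move (q := interleave p p') (w := interleave r r')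
    (2 * ·) (2 * ·) hb hs (by simp) (by simp)
  obtain ⟨u', hbu', hu'⟩ := IsBounded.move (q := interleave p p') (w := interleave r r')
    (2 * · + 1) (2 * · + 1) hb' hs' (by simp) (by simp)
  exact ⟨u, u', _, _, hbu, hbu', hu, hu'⟩

theorem IsBounded.common_term {t : (ℕ → M) → M} {P : (ℕ → M) → Prop} (h : IsTerm t)
    (h' : IsBounded V P) : ∃ (s : Tm) (φ : Fm) (p : ℕ → M) (r : ℕ → V), φ.Bounded ∧
      (∀ e, s.eval (interleave e p) = t e) ∧ ∀ e, φ.Sat (interleave e p) r ↔ P e := by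
  obtain ⟨s, p, hs⟩ := h
  obtain ⟨s', p', r', hb', hs'⟩ := h'
  obtain ⟨u, hu⟩ := IsTerm.move (q := interleave p p') (2 * ·) hs (by simp)
  obtain ⟨u', hbu', hu'⟩ := IsBounded.move (q := interleave p p') (w := r')
    (2 * · + 1) id hb' hs' (by simp) (by simp)
  exact ⟨u, u', _, _, hbu', hu, hu'⟩

instance IsBounded.mem {t : (ℕ → M) → M} [ht : IsTerm t] (A : V) :
    IsBounded V fun e => t e ∈ A := by
  obtain ⟨s, p, h⟩ := ht
  exact ⟨.mem s 0, p, fun _ => A, .mem _ _, fun e => by simp [Fm.Sat, h]⟩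

instance IsBounded.imp {P Q : (ℕ → M) → Prop} [hP : IsBounded V P] [hQ : IsBounded V Q] :
    IsBounded V fun e => P e → Q e := by
  obtain ⟨φ, ψ, p, r, h1, h2, h3, h4⟩ := hP.common hQ
  exact ⟨φ ➝ ψ, p, r, .imp h1 h2, fun e => by simp [Fm.Sat, h3, h4]⟩

instance IsBounded.ball {t : (ℕ → M) → M} {P : (ℕ → M) → M → Prop} [ht : IsTerm t]
    [hP : IsBounded V fun e => P (fun i => e (i + 1)) (e 0)] :
    IsBounded V fun e => ∀ m, m < t e → P e m := by
  obtain ⟨s, φ, p, r, h1, h2, h3⟩ := IsBounded.common_term ht hP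
  refine ⟨.all (.lt (.var 0) s.shift ➝
    -- The binder moves every variable up by one and breaks the parity convention. Argument 0 is the
    -- bound variable, argument `i + 1` is now found at `2 * i + 1`, and parameter `i` at `2 * i +
    -- 2`.
    φ.subst (interleave (fun i => Nat.casesOn i (.var 0) fun i => .var (2 * i + 1))
      fun i => .var (2 * i + 1 + 1)) id), p, r, .ball _ (h1.subst _ _), fun e => ?_⟩
  simp only [Fm.Sat, Tm.eval_shift, h2, Fm.sat_subst]
  refine forall_congr' fun m => imp_congr Iff.rfl ?_
  have := h3 (consVar m e)
  simp only [consVar] at this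
  rw [← this]
  refine iff_of_eq (congrArg (fun f => φ.Sat f r) (funext fun i => ?_))
  refine even_or_odd_cases i (fun i => ?_) (fun i => ?_)
  · cases i with
    | zero => simp only [interleave_even]; rfl
    | succ i => simp [Tm.eval, consVar]
  · simp [Tm.eval, consVar]

theorem IsBounded.rename {P : (ℕ → M) → Prop} (h : IsBounded V P) (f : ℕ → ℕ) :
    IsBounded V fun e => P fun i => e (f i) := by
  obtain ⟨φ, p, r, h1, h2⟩ := h
  refine ⟨φ.subst (interleave (fun i => .var (2 * f i)) fun i => .var (2 * i + 1)) id,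
    p, r, h1.subst _ _, fun e => ?_⟩
  rw [← h2, Fm.sat_subst]
  refine iff_of_eq (congrArg (fun f => φ.Sat f r) (funext fun i => ?_))
  refine even_or_odd_cases i (fun i => ?_) (fun i => ?_) <;> simp [Tm.eval]

theorem IsBounded.subst_zero {P : (ℕ → M) → Prop} (h : IsBounded V P) {t : (ℕ → M) → M}
    (ht : IsTerm t) : IsBounded V fun e => P (consVar (t e) e) := by
  obtain ⟨s, φ, p, r, h1, h2, h3⟩ := IsBounded.common_term ht h
  refine ⟨φ.subst (interleave (fun i => Nat.casesOn i s fun i => .var (2 * i))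
    fun i => .var (2 * i + 1)) id, p, r, h1.subst _ _, fun e => ?_⟩
  rw [← h3, Fm.sat_subst]
  refine iff_of_eq (congrArg (fun f => φ.Sat f r) (funext fun i => ?_))
  refine even_or_odd_cases i (fun i => ?_) (fun i => ?_)
  · cases i with
    | zero => simp only [interleave_even]; exact h2 e
    | succ i => simp [Tm.eval, consVar]
  · simp [Tm.eval]

/-- Substitution of a term into a unary predicate. -/
theorem IsBounded.comp {P : M → Prop} (h : IsBounded V fun e : ℕ → M => P (e 0))
    (t : (ℕ → M) → M) [ht : IsTerm t] : IsBounded V fun e => P (t e) :=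
  h.subst_zero ht

/-- Substitution of terms into a binary predicate. -/
theorem IsBounded.comp₂ {P : M → M → Prop} (h : IsBounded V fun e : ℕ → M => P (e 0) (e 1))
    (s t : (ℕ → M) → M) [hs : IsTerm s] [ht : IsTerm t] : IsBounded V fun e => P (s e) (t e) :=
  -- The first substitution leaves the second argument at index 0 and the original environment from
  -- index 1 on, hence the shift of `s`.
  ((h.rename (fun i => i)).subst_zero (hs.rename (· + 1))).subst_zero ht

variable [Nonempty V]

instance IsBounded.eq {s t : (ℕ → M) → M} [hs : IsTerm s] [ht : IsTerm t] :
    IsBounded V fun e => s e = t e := by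
  obtain ⟨u, v, p, h1, h2⟩ := hs.common ht
  exact ⟨.eq u v, p, fun _ => Classical.arbitrary V, .eq _ _, fun e => by simp [Fm.Sat, h1, h2]⟩

instance IsBounded.lt {s t : (ℕ → M) → M} [hs : IsTerm s] [ht : IsTerm t] :
    IsBounded V fun e => s e < t e := by
  obtain ⟨u, v, p, h1, h2⟩ := hs.common ht
  exact ⟨.lt u v, p, fun _ => Classical.arbitrary V, .lt _ _, fun e => by simp [Fm.Sat, h1, h2]⟩

instance IsBounded.prop (q : Prop) : IsBounded V fun _ : ℕ → M => q := by
  by_cases hq : q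
  · exact ⟨.imp .fls .fls, fun _ => 0, fun _ => Classical.arbitrary V, .imp .fls .fls,
      fun e => by simp [Fm.Sat, hq]⟩
  · exact ⟨.fls, fun _ => 0, fun _ => Classical.arbitrary V, .fls, fun e => by simp [Fm.Sat, hq]⟩

instance IsBounded.not {P : (ℕ → M) → Prop} [hP : IsBounded V P] : IsBounded V fun e => ¬ P e :=
  IsBounded.imp (Q := fun _ => False)

instance IsBounded.and {P Q : (ℕ → M) → Prop} [hP : IsBounded V P] [hQ : IsBounded V Q] :
    IsBounded V fun e => P e ∧ Q e :=
  (inferInstance : IsBounded V fun e => ¬ (P e → ¬ Q e)).congr fun e => by simp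

instance IsBounded.or {P Q : (ℕ → M) → Prop} [hP : IsBounded V P] [hQ : IsBounded V Q] :
    IsBounded V fun e => P e ∨ Q e :=
  (inferInstance : IsBounded V fun e => (¬ P e → Q e)).congr fun e => by tauto

instance IsBounded.iff {P Q : (ℕ → M) → Prop} [hP : IsBounded V P] [hQ : IsBounded V Q] :
    IsBounded V fun e => (P e ↔ Q e) :=
  (inferInstance : IsBounded V fun e => (P e → Q e) ∧ (Q e → P e)).congr fun e => by tauto

instance IsBounded.bex {t : (ℕ → M) → M} {P : (ℕ → M) → M → Prop} [ht : IsTerm t]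
    [hP : IsBounded V fun e => P (fun i => e (i + 1)) (e 0)] :
    IsBounded V fun e => ∃ m, m < t e ∧ P e m :=
  (inferInstance : IsBounded V fun e => ¬ ∀ m, m < t e → ¬ P e m).congr fun e => by simp

end Definability

/-! ## Models of `RCA₀` -/

section Models

variable {M V : Type} [Zero M] [One M] [Add M] [Mul M] [LT M] [Membership M V]

variable (M V) in
/-- The structure with number sort `M` and set sort `V` is a model of `RCA₀`. -/
def IsModel : Prop := ∀ φ ∈ RCA0, ∀ (e : ℕ → M) (r : ℕ → V), φ.Sat e r

/-- A bounded binary predicate, as a formula whose variables `0` and `1` are the second and the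
first argument. -/
theorem IsBounded.exists_formula {P : M → M → Prop}
    (hP : IsBounded V fun e : ℕ → M => P (e 0) (e 1)) :
    ∃ (θ : Fm) (p : ℕ → M) (r : ℕ → V), θ.Bounded ∧
      ∀ n m, θ.Sat (consVar m (consVar n p)) r ↔ P n m := by
  obtain ⟨φ, p, r, h1, h2⟩ := hP
  refine ⟨φ.subst (interleave (fun i => if i = 0 then .var 1 else .var 0) fun i => .var (i + 2)) id,
    p, r, h1.subst _ _, fun n m => ?_⟩
  rw [Fm.sat_subst]
  refine Iff.trans (iff_of_eq (congrArg (fun f => φ.Sat f r) (funext fun i => ?_)))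
    (h2 (fun i => if i = 0 then n else m))
  refine even_or_odd_cases i (fun i => ?_) (fun i => ?_)
  · simp only [interleave_even]
    split_ifs <;> simp [Tm.eval, consVar]
  · simp [Tm.eval, consVar]

/-- The separate witness argument keeps the matrix bounded. Constructions in the model are carried
out as inductions on the existence of a code. -/
theorem IsModel.sigma_induction (hM : IsModel M V) {P : M → M → Prop}
    (hP : IsBounded V fun e : ℕ → M => P (e 0) (e 1)) (h0 : ∃ m, P 0 m)
    (hs : ∀ n, (∃ m, P n m) → ∃ m, P (n + 1) m) (n : M) : ∃ m, P n m := by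
  obtain ⟨θ, p, r, h1, h2⟩ := hP.exists_formula
  have h := hM _ (.induction (φ := .ex θ) ⟨θ, h1, rfl⟩) p r
  -- This covers both instances in the induction axiom, φ(0) and φ(n + 1), whose substitutions
  -- differ on the parameters.
  have key : ∀ (t : Tm) (σ : ℕ → Tm) (e : ℕ → M), (∀ i, (σ i).eval e = p i) →
      (((Fm.ex θ).subst (consVar t σ) id).Sat e r ↔ ∃ m, P (t.eval e) m) := by
    intro t σ e hσ
    rw [Fm.sat_subst, Fm.sat_ex]
    refine exists_congr fun m => ?_
    rw [← h2]
    refine iff_of_eq (congrArg (fun f => θ.Sat (consVar m f) r) (funext fun i => ?_))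
    cases i with
    | zero => rfl
    | succ i => exact hσ i
  have key' : ∀ n, ((Fm.ex θ).Sat (consVar n p) r ↔ ∃ m, P n m) := fun n => by
    simp only [Fm.sat_ex, h2]
  simp only [inductionAxiom, Fm.sat_imp, Fm.sat_and, Fm.Sat, Fm.inst] at h
  rw [key _ _ _ (fun i => rfl)] at h
  refine (key' n).1 (h ⟨h0, fun n hn => ?_⟩ n)
  rw [key _ _ _ (fun i => rfl)]
  exact hs n ((key' n).1 hn)

theorem IsModel.induction (hM : IsModel M V) {P : M → Prop}
    (hP : IsBounded V fun e : ℕ → M => P (e 0)) (h0 : P 0) (hs : ∀ n, P n → P (n + 1)) (n : M) :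
    P n := by
  obtain ⟨m, hm⟩ := hM.sigma_induction (P := fun n _ => P n) hP ⟨0, h0⟩
    (fun n ⟨m, hm⟩ => ⟨m, hs n hm⟩) n
  exact hm

theorem IsModel.comprehension (hM : IsModel M V) {P Q : M → M → Prop}
    (hP : IsBounded V fun e : ℕ → M => P (e 0) (e 1))
    (hQ : IsBounded V fun e : ℕ → M => Q (e 0) (e 1))
    (h : ∀ n, (∃ m, P n m) ↔ ∀ m, Q n m) : ∃ A : V, ∀ n, n ∈ A ↔ ∃ m, P n m := by
  obtain ⟨φ, p, r, h1, h2⟩ := hP.exists_formula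
  obtain ⟨ψ, q, s, h3, h4⟩ := hQ.exists_formula
  -- The two formulas have unrelated parameters. They are interleaved, even places for φ and odd
  -- ones for ψ, and the two innermost variables stay fixed.
  let σ (f : ℕ → ℕ) : ℕ → Tm := consVar (.var 0) (consVar (.var 1) fun i => .var (f i + 2))
  have hσ : ∀ (f : ℕ → ℕ) (m n : M) (e e' : ℕ → M), (∀ i, e (f i) = e' i) →
      (fun i => (σ f i).eval (consVar m (consVar n e))) = consVar m (consVar n e') := by
    intro f m n e e' he
    funext i
    match i with
    | 0 => rfl
    | 1 => rfl
    | i + 2 => exact he i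
  have h' := hM _ (.comprehension (φ := .ex (φ.subst (σ (2 * ·)) (2 * ·)))
    (ψ := .all (ψ.subst (σ (2 * · + 1)) (2 * · + 1))) ⟨_, h1.subst _ _, rfl⟩
    ⟨_, h3.subst _ _, rfl⟩) (interleave p q) (interleave r s)
  have hφ : ∀ n, (Fm.ex (φ.subst (σ (2 * ·)) (2 * ·))).Sat (consVar n (interleave p q))
      (interleave r s) ↔ ∃ m, P n m := by
    intro n
    rw [Fm.sat_ex]
    refine exists_congr fun m => ?_
    rw [Fm.sat_subst, hσ _ _ _ _ p (by simp)]
    simp only [interleave_even]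
    exact h2 n m
  have hψ : ∀ n, (Fm.all (ψ.subst (σ (2 * · + 1)) (2 * · + 1))).Sat (consVar n (interleave p q))
      (interleave r s) ↔ ∀ m, Q n m := by
    intro n
    refine forall_congr' fun m => ?_
    rw [Fm.sat_subst, hσ _ _ _ _ q (by simp)]
    simp only [interleave_odd]
    exact h4 n m
  rw [comprehensionAxiom, Fm.sat_imp] at h'
  have h'' := h' fun n => by rw [Fm.sat_iff, hφ, hψ, h n]
  rw [Fm.sat_exSet] at h''
  obtain ⟨A, hA⟩ := h''
  refine ⟨A, fun n => ?_⟩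
  have := hA n
  rw [Fm.sat_iff, Fm.shiftSet, Fm.sat_subst] at this
  exact Iff.trans this (hφ n)

theorem IsModel.exists_set (hM : IsModel M V) {P : M → Prop}
    (hP : IsBounded V fun e : ℕ → M => P (e 0)) : ∃ A : V, ∀ n, n ∈ A ↔ P n := by
  have := hM.comprehension (P := fun n _ => P n) (Q := fun n _ => P n) hP hP fun n =>
    ⟨fun ⟨_, h⟩ _ => h, fun h => ⟨0, h 0⟩⟩
  obtain ⟨A, hA⟩ := this
  exact ⟨A, fun n => (hA n).trans ⟨fun ⟨_, h⟩ => h, fun h => ⟨0, h⟩⟩⟩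

theorem IsModel.basic (hM : IsModel M V) (r : ℕ → V) {φ : Fm} (hφ : BasicAxiom φ) (m n : M) :
    φ.Sat (consVar m fun _ => n) r := hM _ (.basic hφ) _ _

/-! ### Arithmetic and order of the number sort -/

section Arithmetic

variable [Nonempty V] (hM : IsModel M V)

include hM

protected theorem IsModel.succ_ne_zero (m : M) : m + 1 ≠ 0 :=
  hM.basic (fun _ => Classical.arbitrary V) .succ_ne_zero m m

protected theorem IsModel.succ_inj (m n : M) : m + 1 = n + 1 → m = n :=
  hM.basic (fun _ => Classical.arbitrary V) .succ_inj m n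

protected theorem IsModel.add_zero (m : M) : m + 0 = m :=
  hM.basic (fun _ => Classical.arbitrary V) .add_zero m m

protected theorem IsModel.add_succ (m n : M) : m + (n + 1) = m + n + 1 :=
  hM.basic (fun _ => Classical.arbitrary V) .add_succ m n

protected theorem IsModel.mul_zero (m : M) : m * 0 = 0 :=
  hM.basic (fun _ => Classical.arbitrary V) .mul_zero m m

protected theorem IsModel.mul_succ (m n : M) : m * (n + 1) = m * n + m :=
  hM.basic (fun _ => Classical.arbitrary V) .mul_succ m n

protected theorem IsModel.not_lt_zero (m : M) : ¬ m < 0 :=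
  hM.basic (fun _ => Classical.arbitrary V) .not_lt_zero m m

protected theorem IsModel.lt_succ (m n : M) : m < n + 1 ↔ m < n ∨ m = n := by
  have := hM.basic (fun _ => Classical.arbitrary V) .lt_succ m n
  rwa [Fm.sat_iff, Fm.sat_or] at this

protected theorem IsModel.zero_add (m : M) : 0 + m = m := by
  refine hM.induction (P := fun m => 0 + m = m) inferInstance (hM.add_zero 0) (fun n h => ?_) m
  rw [hM.add_succ, h]

protected theorem IsModel.succ_add (m n : M) : m + 1 + n = m + n + 1 := by
  refine hM.induction (P := fun n => m + 1 + n = m + n + 1) inferInstance ?_ (fun n h => ?_) n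
  · rw [hM.add_zero, hM.add_zero]
  · rw [hM.add_succ, h, hM.add_succ]

protected theorem IsModel.add_comm (m n : M) : m + n = n + m := by
  refine hM.induction (P := fun n => m + n = n + m) inferInstance ?_ (fun n h => ?_) n
  · rw [hM.add_zero, hM.zero_add]
  · rw [hM.add_succ, h, hM.succ_add]

protected theorem IsModel.add_assoc (l m n : M) : l + m + n = l + (m + n) := by
  refine hM.induction (P := fun n => l + m + n = l + (m + n)) inferInstance ?_ (fun n h => ?_) n
  · rw [hM.add_zero, hM.add_zero]
  · rw [hM.add_succ, h, hM.add_succ, hM.add_succ]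

protected theorem IsModel.zero_mul (m : M) : 0 * m = 0 := by
  refine hM.induction (P := fun m => 0 * m = 0) inferInstance (hM.mul_zero 0) (fun n h => ?_) m
  rw [hM.mul_succ, h, hM.add_zero]

protected theorem IsModel.succ_mul (m n : M) : (m + 1) * n = m * n + n := by
  refine hM.induction (P := fun n => (m + 1) * n = m * n + n) inferInstance ?_ (fun n h => ?_) n
  · rw [hM.mul_zero, hM.mul_zero, hM.add_zero]
  · rw [hM.mul_succ, h, hM.mul_succ, hM.add_assoc, hM.add_assoc, hM.add_succ n, hM.add_succ m,
      hM.add_comm n]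

protected theorem IsModel.mul_comm (m n : M) : m * n = n * m := by
  refine hM.induction (P := fun n => m * n = n * m) inferInstance ?_ (fun n h => ?_) n
  · rw [hM.mul_zero, hM.zero_mul]
  · rw [hM.mul_succ, h, hM.succ_mul]

protected theorem IsModel.mul_add (l m n : M) : l * (m + n) = l * m + l * n := by
  refine hM.induction (P := fun n => l * (m + n) = l * m + l * n) inferInstance ?_
    (fun n h => ?_) n
  · rw [hM.mul_zero, hM.add_zero, hM.add_zero]
  · rw [hM.add_succ, hM.mul_succ, h, hM.mul_succ, hM.add_assoc]

protected theorem IsModel.mul_assoc (l m n : M) : l * m * n = l * (m * n) := by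
  refine hM.induction (P := fun n => l * m * n = l * (m * n)) inferInstance ?_ (fun n h => ?_) n
  · rw [hM.mul_zero, hM.mul_zero, hM.mul_zero]
  · rw [hM.mul_succ, h, hM.mul_succ, hM.mul_add]

protected theorem IsModel.one_mul (m : M) : 1 * m = m := by
  rw [← hM.zero_add 1, hM.succ_mul, hM.zero_mul, hM.zero_add]

protected theorem IsModel.add_right_cancel (l m n : M) : l + n = m + n → l = m := by
  refine hM.induction (P := fun n => l + n = m + n → l = m) inferInstance ?_ (fun n h h' => ?_) n
  · rw [hM.add_zero, hM.add_zero]; exact id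
  · rw [hM.add_succ, hM.add_succ] at h'
    exact h (hM.succ_inj _ _ h')

/-- This reduces the order, axiomatized by recursion, to addition, so that further order facts
become algebra. -/
protected theorem IsModel.lt_iff (m n : M) : m < n ↔ ∃ l, m + (l + 1) = n := by
  constructor
  · intro hmn
    -- The hypothesis `m < n` goes inside the existential quantifier, so that the induction formula
    -- is Σ⁰₁.
    refine (hM.sigma_induction (P := fun n l => m < n → m + (l + 1) = n) inferInstance
      ⟨0, fun h => (hM.not_lt_zero m h).elim⟩ (fun n ⟨l, hl⟩ => ?_) n).imp fun l hl => hl hmn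
    by_cases h : m < n
    · exact ⟨l + 1, fun _ => by rw [hM.add_succ, hl h]⟩
    · refine ⟨0, fun h' => ?_⟩
      rcases (hM.lt_succ m n).1 h' with h' | rfl
      · exact (h h').elim
      · rw [hM.zero_add]
  · rintro ⟨l, rfl⟩
    refine hM.induction (P := fun l => m < m + (l + 1)) inferInstance ?_ (fun l h => ?_) l
    · rw [hM.zero_add]; exact (hM.lt_succ m m).2 (.inr rfl)
    · rw [hM.add_succ]; exact (hM.lt_succ _ _).2 (.inl h)

protected theorem IsModel.eq_zero_or_succ (m : M) : m = 0 ∨ ∃ n, m = n + 1 := by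
  by_cases h : m = 0
  · exact .inl h
  obtain ⟨n, hn⟩ := hM.sigma_induction (P := fun m n => m = 0 ∨ m = n + 1) inferInstance
    ⟨0, .inl rfl⟩ (fun n _ => ⟨n, .inr rfl⟩) m
  exact hn.imp_right fun h => ⟨n, h⟩

protected theorem IsModel.lt_trichotomy (m n : M) : m < n ∨ m = n ∨ n < m := by
  refine hM.induction (P := fun m => m < n ∨ m = n ∨ n < m) inferInstance ?_ (fun m h => ?_) m
  · rcases hM.eq_zero_or_succ n with h | ⟨l, h⟩
    · exact .inr (.inl h.symm)
    · exact .inl ((hM.lt_iff _ _).2 ⟨l, by rw [hM.zero_add, h]⟩)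
  · rcases h with h | h | h
    · obtain ⟨l, hl⟩ := (hM.lt_iff _ _).1 h
      rcases hM.eq_zero_or_succ l with h' | ⟨i, h'⟩
      · rw [h', hM.zero_add] at hl
        exact .inr (.inl hl)
      · refine .inl ((hM.lt_iff _ _).2 ⟨i, ?_⟩)
        rw [hM.succ_add, ← h', ← hl, hM.add_succ]
    · exact .inr (.inr ((hM.lt_succ _ _).2 (.inr h.symm)))
    · exact .inr (.inr ((hM.lt_succ _ _).2 (.inl h)))

protected theorem IsModel.lt_irrefl (m : M) : ¬ m < m := by
  intro h
  obtain ⟨l, hl⟩ := (hM.lt_iff _ _).1 h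
  refine hM.succ_ne_zero l (hM.add_right_cancel _ _ m ?_)
  rw [hM.zero_add, hM.add_comm, hl]

protected theorem IsModel.lt_trans (l m n : M) (h1 : l < m) (h2 : m < n) : l < n := by
  obtain ⟨i, rfl⟩ := (hM.lt_iff _ _).1 h1
  obtain ⟨j, rfl⟩ := (hM.lt_iff _ _).1 h2
  exact (hM.lt_iff _ _).2 ⟨i + 1 + j, by rw [hM.add_assoc l, hM.add_succ (i + 1)]⟩

end Arithmetic

/-- The number sort of a model of `RCA₀` as a commutative semiring. -/
abbrev IsModel.commSemiring [Nonempty V] (hM : IsModel M V) : CommSemiring M where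
  add_assoc := hM.add_assoc
  zero_add := hM.zero_add
  add_zero := hM.add_zero
  add_comm := hM.add_comm
  nsmul := nsmulRec
  left_distrib := hM.mul_add
  right_distrib l m n := by rw [hM.mul_comm, hM.mul_add, hM.mul_comm n, hM.mul_comm n]
  zero_mul := hM.zero_mul
  mul_zero := hM.mul_zero
  mul_assoc := hM.mul_assoc
  one_mul := hM.one_mul
  mul_one m := by rw [hM.mul_comm, hM.one_mul]
  mul_comm := hM.mul_comm

open Classical in
/-- The number sort of a model of `RCA₀` as a linear order. -/
noncomputable abbrev IsModel.linearOrder [Nonempty V] (hM : IsModel M V) : LinearOrder M where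
  le m n := m < n ∨ m = n
  le_refl m := .inr rfl
  le_trans l m n := by
    rintro (h | rfl) (h' | rfl)
    · exact .inl (hM.lt_trans _ _ _ h h')
    · exact .inl h
    · exact .inl h'
    · exact .inr rfl
  lt_iff_le_not_ge m n := by
    refine ⟨fun h => ⟨.inl h, ?_⟩, fun ⟨h1, h2⟩ => ?_⟩
    · rintro (h' | rfl)
      · exact hM.lt_irrefl _ (hM.lt_trans _ _ _ h h')
      · exact hM.lt_irrefl _ h
    · rcases h1 with h1 | rfl
      · exact h1
      · exact (h2 (.inr rfl)).elim
  le_antisymm m n := by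
    rintro (h | rfl) (h' | h')
    · exact (hM.lt_irrefl _ (hM.lt_trans _ _ _ h h')).elim
    · exact h'.symm
    · rfl
    · rfl
  le_total m n := by
    rcases hM.lt_trichotomy m n with h | h | h
    · exact .inl (.inl h)
    · exact .inl (.inr h)
    · exact .inr (.inl h)
  toDecidableLE := Classical.decRel _

theorem IsModel.isStrictOrderedRing [Nonempty V] (hM : IsModel M V) :
    letI := hM.commSemiring
    letI := hM.linearOrder
    IsStrictOrderedRing M := by
  let _ := hM.commSemiring
  let _ := hM.linearOrder
  have hadd : ∀ l m n : M, l < m → l + n < m + n := by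
    intro l m n h
    obtain ⟨i, rfl⟩ := (hM.lt_iff _ _).1 h
    exact (hM.lt_iff _ _).2 ⟨i, by ring⟩
  have hmul : ∀ l m n : M, 0 < l → m < n → l * m < l * n := by
    intro l m n h h'
    obtain ⟨i, rfl⟩ := (hM.lt_iff _ _).1 h
    obtain ⟨j, rfl⟩ := (hM.lt_iff _ _).1 h'
    exact (hM.lt_iff _ _).2 ⟨i * j + i + j, by ring⟩
  have h01 : (0 : M) < 1 := (hM.lt_iff _ _).2 ⟨0, by ring⟩
  exact
    { add_le_add_left := fun l m h n => h.elim (fun h => .inl (hadd l m n h)) fun h => by rw [h]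
      le_of_add_le_add_left := fun l m n h => by
        by_contra h'
        have := hadd _ _ l (not_le.1 h')
        rw [_root_.add_comm n, _root_.add_comm m] at this
        exact absurd this (not_lt.2 h)
      zero_le_one := h01.le
      exists_pair_ne := ⟨0, 1, h01.ne⟩
      mul_lt_mul_of_pos_left := fun {l} hl {m n} h => hmul l m n hl h
      mul_lt_mul_of_pos_right := fun {l} hl {m n} h => by
        simpa only [_root_.mul_comm] using hmul l m n hl h }

theorem IsModel.canonicallyOrderedAdd [Nonempty V] (hM : IsModel M V) :
    letI := hM.commSemiring
    letI := hM.linearOrder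
    CanonicallyOrderedAdd M := by
  let _ := hM.commSemiring
  let _ := hM.linearOrder
  have hle : ∀ m n : M, m ≤ m + n := by
    intro m n
    rcases hM.eq_zero_or_succ n with rfl | ⟨l, rfl⟩
    · simp
    · exact .inl ((hM.lt_iff _ _).2 ⟨l, rfl⟩)
  have hex : ∀ {m n : M}, m ≤ n → ∃ l, n = m + l := by
    rintro m n (h | rfl)
    · obtain ⟨i, rfl⟩ := (hM.lt_iff _ _).1 h
      exact ⟨_, rfl⟩
    · exact ⟨0, by simp⟩
  exact
    { exists_add_of_le := hex
      le_add_self := fun m n => by rw [_root_.add_comm]; exact hle m n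
      le_self_add := hle }

end Models

/-! ### Discreteness of the order and least elements -/

section OrderedSemiring

variable {M V : Type} [CommSemiring M] [LinearOrder M] [IsStrictOrderedRing M]
  [CanonicallyOrderedAdd M] [Membership M V] [Nonempty V]

instance IsBounded.le {s t : (ℕ → M) → M} [IsTerm s] [IsTerm t] :
    IsBounded V fun e => s e ≤ t e :=
  (inferInstance : IsBounded V fun e => ¬ t e < s e).congr fun _ => not_lt

theorem IsModel.lt_add_one_iff (hM : IsModel M V) {m n : M} : m < n + 1 ↔ m ≤ n := by
  rw [hM.lt_succ, le_iff_lt_or_eq]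

theorem IsModel.add_one_le_iff (hM : IsModel M V) {m n : M} : m + 1 ≤ n ↔ m < n := by
  rw [← not_lt, hM.lt_add_one_iff, not_le]

theorem IsModel.one_le (hM : IsModel M V) {m : M} (h : 0 < m) : 1 ≤ m := by
  simpa using hM.add_one_le_iff.2 h

theorem IsModel.le_mul (hM : IsModel M V) {m n : M} (h : 0 < m) : n ≤ m * n :=
  le_mul_of_one_le_left zero_le (hM.one_le h)

/-- Without a least element, induction on `n` shows that nothing below `n` satisfies `P`; this
induction formula is bounded. -/
theorem IsModel.exists_least (hM : IsModel M V) {P : M → Prop}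
    (hP : IsBounded V fun e : ℕ → M => P (e 0)) {n : M} (hn : P n) :
    ∃ m, P m ∧ ∀ l < m, ¬ P l := by
  by_contra hc
  push Not at hc
  have hP' : ∀ (s : (ℕ → M) → M) [IsTerm s], IsBounded V fun e => P (s e) := fun s _ => hP.comp s
  have := hM.induction (P := fun n => ∀ l, l < n → ¬ P l) inferInstance
    (fun l h => absurd h _root_.not_lt_zero) (fun n h l hl hPl => ?_) (n + 1)
  · exact this n (lt_add_one n) hn
  · obtain ⟨i, hi, hPi⟩ := hc l hPl
    exact h i (hi.trans_le (hM.lt_add_one_iff.1 hl)) hPi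

/-! ### Pairs -/

/-- The pairing function. -/
def mpair (m n : M) : M := (m + n) * (m + n) + m

instance IsTerm.mpair {s t : (ℕ → M) → M} [IsTerm s] [IsTerm t] :
    IsTerm fun e => mpair (s e) (t e) :=
  inferInstanceAs (IsTerm fun e => (s e + t e) * (s e + t e) + s e)

theorem left_le_mpair (m n : M) : m ≤ mpair m n := le_add_self

theorem IsModel.right_le_mpair (hM : IsModel M V) (m n : M) : n ≤ mpair m n := by
  rcases eq_zero_or_pos n with rfl | h
  · exact zero_le
  calc n ≤ m + n := le_add_self
    _ ≤ (m + n) * (m + n) := hM.le_mul (h.trans_le le_add_self)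
    _ ≤ mpair m n := le_self_add

/-- The code of a pair with sum s lies between s² and (s+1)², the latter excluded, so it determines
s. -/
theorem IsModel.sum_le_of_mpair_eq (hM : IsModel M V) {m n k l : M} (h : mpair m n = mpair k l) :
    m + n ≤ k + l := by
  by_contra hc
  have h1 := hM.add_one_le_iff.2 (not_le.1 hc)
  have h2 : (k + l + 1) * (k + l + 1) ≤ (m + n) * (m + n) := mul_le_mul' h1 h1
  have h3 : (m + n) * (m + n) ≤ mpair k l := h ▸ le_self_add
  have h4 : (k + l + 1) * (k + l + 1) = mpair k l + (k + l + l + 1) := by unfold mpair; ring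
  have h5 : mpair k l < mpair k l + (k + l + l + 1) := lt_add_of_pos_right _ (by positivity)
  exact absurd (h4 ▸ h2.trans h3) (not_le.2 h5)

theorem IsModel.mpair_inj (hM : IsModel M V) {m n k l : M} :
    mpair m n = mpair k l ↔ m = k ∧ n = l := by
  refine ⟨fun h => ?_, fun ⟨h1, h2⟩ => by rw [h1, h2]⟩
  have h1 : m + n = k + l := le_antisymm (hM.sum_le_of_mpair_eq h) (hM.sum_le_of_mpair_eq h.symm)
  have h2 : m = k := by
    unfold mpair at h
    rw [h1] at h
    exact add_left_cancel h
  subst h2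
  exact ⟨rfl, add_left_cancel h1⟩

/-! ### Codes of finite sets -/

/-- Subtraction is unavailable, so the quotients are compared instead; if the quotient of `m` is the
larger, then `n` is 0. -/
theorem dvd_of_dvd_add {p m n : M} (h : p ∣ m + n) (hm : p ∣ m) : p ∣ n := by
  obtain ⟨k, hk⟩ := h
  obtain ⟨l, rfl⟩ := hm
  rcases le_total l k with hlk | hlk
  · obtain ⟨i, rfl⟩ := exists_add_of_le hlk
    rw [mul_add] at hk
    exact ⟨i, add_left_cancel hk⟩
  · have h1 : p * l + n ≤ p * l + 0 := by
      rw [hk, add_zero]; exact mul_le_mul_right hlk p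
    have h2 : n = 0 := le_zero_iff.1 (le_of_add_le_add_left h1)
    rw [h2]; exact dvd_zero _

/-- A quotient may be taken at most the dividend: this is automatic for a positive divisor, and for
divisor 0 the quotient 0 serves. -/
theorem IsModel.isBounded_dvd (hM : IsModel M V) (s t : (ℕ → M) → M) [IsTerm s] [IsTerm t] :
    IsBounded V fun e => s e ∣ t e := by
  refine IsBounded.comp₂ (P := (· ∣ ·)) ((inferInstance : IsBounded V fun e : ℕ → M =>
    ∃ q, q < e 1 + 1 ∧ e 1 = e 0 * q).congr fun e => ?_) s t
  refine ⟨fun ⟨q, _, h⟩ => ⟨q, h⟩, fun ⟨q, h⟩ => ?_⟩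
  rcases eq_zero_or_pos (e 0) with h0 | h0
  · exact ⟨0, by positivity, by rw [h, h0]; simp⟩
  · refine ⟨q, hM.lt_add_one_iff.2 ?_, h⟩
    rw [h]; exact hM.le_mul h0

/-- A substitute for the factorial: only the existence of the multiple is carried through the
induction. -/
theorem IsModel.exists_common_multiple (hM : IsModel M V) (n : M) :
    ∃ b : M, 0 < b ∧ ∀ d, d < n → d + 1 ∣ b := by
  have hdvd := hM.isBounded_dvd
  have hP : IsBounded V fun e : ℕ → M => 0 < e 1 ∧ ∀ d, d < e 0 → d + 1 ∣ e 1 := inferInstance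
  refine hM.sigma_induction (P := fun n b => 0 < b ∧ ∀ d, d < n → d + 1 ∣ b) hP
    ⟨1, one_pos, fun d h => absurd h _root_.not_lt_zero⟩ ?_ n
  rintro n ⟨b, hb, h⟩
  refine ⟨b * (n + 1), by positivity, fun d hd => ?_⟩
  rcases (hM.lt_add_one_iff.1 hd).lt_or_eq with hd | rfl
  · exact (h d hd).mul_right _
  · exact dvd_mul_left _ _

/-- The moduli used in codes of finite sets. -/
def modulus (b u : M) : M := 1 + (u + 1) * b

instance IsTerm.modulus {s t : (ℕ → M) → M} [IsTerm s] [IsTerm t] :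
    IsTerm fun e => modulus (s e) (t e) :=
  inferInstanceAs (IsTerm fun e => 1 + (t e + 1) * s e)

/-- The modulus is 1 modulo `b`, hence prime to `b`. -/
theorem dvd_of_modulus_dvd_mul_right {b u m : M} (h : modulus b u ∣ m * b) : modulus b u ∣ m := by
  have h1 : modulus b u ∣ m * b * (u + 1) + m :=
    ⟨m, by unfold modulus; ring⟩
  exact dvd_of_dvd_add h1 (h.mul_right _)

/-- Distinct moduli are coprime, in the form of a cancellation law. Their difference is |u - v| · b,
and |u - v| divides `b`, so the modulus divides m · b²; then `b` cancels twice. -/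
theorem IsModel.dvd_of_modulus_dvd_mul (hM : IsModel M V) {b n u v m : M} (hb : ∀ d, d < n → d + 1 ∣ b)
    (hu : u < n) (hv : v < n) (huv : u ≠ v) (h : modulus b u ∣ m * modulus b v) :
    modulus b u ∣ m := by
  have hsucc : ∀ {m n : M}, m < n → m + 1 ≤ n := hM.add_one_le_iff.2
  have key : ∃ d, d < n ∧ modulus b u ∣ m * (d + 1) * b := by
    rcases lt_or_gt_of_ne huv with h1 | h1
    · obtain ⟨d, rfl⟩ := exists_add_of_le (hsucc h1)
      refine ⟨d, (show d ≤ u + 1 + d from le_add_self).trans_lt hv,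
        dvd_of_dvd_add (m := m * modulus b u) ?_ (dvd_mul_left _ _)⟩
      convert h using 1
      unfold modulus; ring
    · obtain ⟨d, rfl⟩ := exists_add_of_le (hsucc h1)
      refine ⟨d, (show d ≤ v + 1 + d from le_add_self).trans_lt hu,
        dvd_of_dvd_add (m := m * modulus b v) ?_ h⟩
      refine Dvd.intro_left m ?_
      unfold modulus; ring
  obtain ⟨d, hd, h1⟩ := key
  obtain ⟨q, hq⟩ := hb d hd
  have h2 : modulus b u ∣ m * b * b := by
    have : m * b * b = m * (d + 1) * b * q := by
      calc m * b * b = m * b * ((d + 1) * q) := by rw [← hq]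
        _ = _ := by ring
    rw [this]; exact h1.mul_right _
  exact dvd_of_modulus_dvd_mul_right (dvd_of_modulus_dvd_mul_right h2)

/-- `u` is an element of the finite set with code `t`. -/
def MemCode (t u : M) : Prop :=
  ∃ b m n, t = mpair b (mpair m n) ∧ u < n ∧ modulus b u ∣ m

theorem IsModel.memCode_mpair (hM : IsModel M V) {b m n u : M} :
    MemCode (mpair b (mpair m n)) u ↔ u < n ∧ modulus b u ∣ m := by
  constructor
  · rintro ⟨b', m', n', h, h'⟩
    rw [hM.mpair_inj, hM.mpair_inj] at h
    obtain ⟨rfl, rfl, rfl⟩ := h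
    exact h'
  · exact fun h => ⟨b, m, n, rfl, h⟩

theorem IsModel.lt_of_memCode (hM : IsModel M V) {t u : M} (h : MemCode t u) : u < t := by
  obtain ⟨b, m, n, rfl, h, -⟩ := h
  exact h.trans_le ((hM.right_le_mpair _ _).trans (hM.right_le_mpair _ _))

theorem IsModel.isBounded_memCode (hM : IsModel M V) (s t : (ℕ → M) → M) [IsTerm s] [IsTerm t] :
    IsBounded V fun e => MemCode (s e) (t e) := by
  have hdvd := hM.isBounded_dvd
  refine IsBounded.comp₂ (P := MemCode) ((inferInstance : IsBounded V fun e : ℕ → M =>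
    ∃ b, b < e 0 + 1 ∧ ∃ m, m < e 0 + 1 ∧ ∃ n, n < e 0 + 1 ∧
      e 0 = mpair b (mpair m n) ∧ e 1 < n ∧ modulus b (e 1) ∣ m).congr fun e => ?_) s t
  constructor
  · rintro ⟨b, -, m, -, n, -, h⟩
    exact ⟨b, m, n, h⟩
  · rintro ⟨b, m, n, h, h'⟩
    refine ⟨b, ?_, m, ?_, n, ?_, h, h'⟩ <;> rw [hM.lt_add_one_iff, h]
    · exact left_le_mpair _ _
    · exact (left_le_mpair _ _).trans (hM.right_le_mpair _ _)
    · exact (hM.right_le_mpair _ _).trans (hM.right_le_mpair _ _)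

/-- The code carries the product of the moduli of all `u < n` in `P`, built one factor at a time; by
coprimality no other modulus divides it. -/
theorem IsModel.exists_code (hM : IsModel M V) {P : M → Prop}
    (hP : IsBounded V fun e : ℕ → M => P (e 0)) (n : M) :
    ∃ t, ∀ u, MemCode t u ↔ u < n ∧ P u := by
  have hdvd := hM.isBounded_dvd
  have hP' : ∀ (s : (ℕ → M) → M) [IsTerm s], IsBounded V fun e => P (s e) := fun s _ => hP.comp s
  obtain ⟨b, hb0, hb⟩ := hM.exists_common_multiple n
  have key : ∃ m, ∀ u, u < n → (modulus b u ∣ m ↔ u < n ∧ P u) := by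
    refine hM.sigma_induction
      (P := fun i m => ∀ u, u < n → (modulus b u ∣ m ↔ u < i ∧ P u)) inferInstance
      ⟨1, fun u hu => ?_⟩ (fun i ⟨m, hm⟩ => ?_) n
    -- The empty product is 1, and each modulus exceeds 1 because `b` is positive.
    · refine iff_of_false (fun h => ?_) (fun h => _root_.not_lt_zero h.1)
      obtain ⟨q, hq⟩ := h
      rcases eq_zero_or_pos q with rfl | hq0
      · simp at hq
      · have h1 : modulus b u ≤ 1 := by
          rw [hq, mul_comm]; exact hM.le_mul hq0
        have h2 : 1 < modulus b u := lt_add_of_pos_right _ (by positivity)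
        exact absurd h1 (not_le.2 h2)
    · by_cases hi : i < n ∧ P i
      · refine ⟨m * modulus b i, fun u hu => ?_⟩
        by_cases hui : u = i
        · subst hui
          exact iff_of_true (dvd_mul_left _ _) ⟨lt_add_one u, hi.2⟩
        · rw [hM.lt_add_one_iff, le_iff_lt_or_eq, or_iff_left hui, ← hm u hu]
          exact ⟨hM.dvd_of_modulus_dvd_mul hb hu hi.1 hui, fun h => h.mul_right _⟩
      · refine ⟨m, fun u hu => ?_⟩
        rw [hm u hu, hM.lt_add_one_iff, le_iff_lt_or_eq]
        refine and_congr_left fun hPu => (or_iff_left ?_).symm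
        rintro rfl
        exact hi ⟨hu, hPu⟩
  obtain ⟨m, hm⟩ := key
  refine ⟨mpair b (mpair m n), fun u => ?_⟩
  rw [hM.memCode_mpair]
  refine and_congr_right fun hu => ?_
  rw [hm u hu]
  exact and_iff_right hu

/-! ### Iteration of functions -/

/-- `t` codes the initial segment of length `n + 1` of the sequence that starts with `m` and whose
successive members are related by `G`. -/
def IsRun (G : M → M → Prop) (m t n : M) : Prop :=
  MemCode t (mpair 0 m) ∧
  (∀ i, i < n + 1 → ∀ v, v < t → ∀ w, w < t →
    MemCode t (mpair i v) → MemCode t (mpair i w) → v = w) ∧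
  ∀ i, i < n → ∀ v, v < t → MemCode t (mpair i v) → ∃ w, w < t ∧ G v w ∧ MemCode t (mpair (i + 1) w)

theorem IsModel.isBounded_isRun (hM : IsModel M V) {G : M → M → Prop}
    (hG : IsBounded V fun e : ℕ → M => G (e 0) (e 1)) (m : M) (s t : (ℕ → M) → M) [IsTerm s]
    [IsTerm t] : IsBounded V fun e => IsRun G m (s e) (t e) := by
  have h1 := hM.isBounded_memCode
  have h2 : ∀ (s t : (ℕ → M) → M) [IsTerm s] [IsTerm t], IsBounded V fun e => G (s e) (t e) :=
    fun s t _ _ => hG.comp₂ s t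
  refine IsBounded.comp₂ (P := IsRun G m) ?_ s t
  unfold IsRun
  infer_instance

theorem IsModel.right_lt_of_memCode (hM : IsModel M V) {t i v : M}
    (h : MemCode t (mpair i v)) : v < t :=
  (hM.right_le_mpair i v).trans_lt (hM.lt_of_memCode h)

/-- Two runs agree. -/
theorem IsModel.exists_common_of_isRun (hM : IsModel M V) {G : M → M → Prop}
    (hGu : ∀ v w w', G v w → G v w' → w = w') {m t t' n : M}
    (h : IsRun G m t n) (h' : IsRun G m t' n) :
    ∃ v, v < t ∧ MemCode t (mpair n v) ∧ MemCode t' (mpair n v) := by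
  have hc := hM.isBounded_memCode
  refine hM.induction (P := fun i => i ≤ n → ∃ v, v < t ∧ MemCode t (mpair i v) ∧
    MemCode t' (mpair i v)) inferInstance
    (fun _ => ⟨m, hM.right_lt_of_memCode h.1, h.1, h'.1⟩) (fun i ih hi => ?_) n le_rfl
  have hi := hM.add_one_le_iff.1 hi
  obtain ⟨v, hv, h1, h2⟩ := ih hi.le
  obtain ⟨w, hw, hG, h3⟩ := h.2.2 i hi v hv h1
  obtain ⟨w', -, hG', h4⟩ := h'.2.2 i hi v (hM.right_lt_of_memCode h2) h2
  rw [hGu v w' w hG' hG] at h4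
  exact ⟨w, hw, h3, h4⟩

theorem IsModel.eq_of_isRun (hM : IsModel M V) {G : M → M → Prop}
    (hGu : ∀ v w w', G v w → G v w' → w = w') {m t t' n v w : M}
    (h : IsRun G m t n) (h' : IsRun G m t' n) (hv : MemCode t (mpair n v))
    (hw : MemCode t' (mpair n w)) : v = w := by
  obtain ⟨l, -, h1, h2⟩ := hM.exists_common_of_isRun hGu h h'
  rw [h.2.1 n (lt_add_one n) v (hM.right_lt_of_memCode hv) l (hM.right_lt_of_memCode h1) hv h1,
    h'.2.1 n (lt_add_one n) w (hM.right_lt_of_memCode hw) l (hM.right_lt_of_memCode h2) hw h2]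

/-- A run can be extended by one step. -/
theorem IsModel.exists_isRun_add_one (hM : IsModel M V) {G : M → M → Prop}
    (hGu : ∀ v w w', G v w → G v w' → w = w') {m t n v w : M}
    (h : IsRun G m t n) (hv : MemCode t (mpair n v)) (hG : G v w) :
    ∃ t', IsRun G m t' (n + 1) ∧ MemCode t' (mpair (n + 1) w) := by
  have hc := hM.isBounded_memCode
  -- The old code is cut at index `n` before the new entry is added, since a run may hold stray
  -- entries with larger indices.
  obtain ⟨t', ht'⟩ := hM.exists_code (P := fun u => (∃ i, i < n + 1 ∧ ∃ v, v < t ∧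
    u = mpair i v ∧ MemCode t u) ∨ u = mpair (n + 1) w) inferInstance (t + mpair (n + 1) w + 1)
  have hold : ∀ i v, i < n + 1 → (MemCode t' (mpair i v) ↔ MemCode t (mpair i v)) := by
    intro i v hi
    rw [ht']
    constructor
    · rintro ⟨-, ⟨j, -, l, -, -, h⟩ | h⟩
      · exact h
      · rw [hM.mpair_inj] at h
        exact absurd hi (h.1 ▸ lt_irrefl _)
    · intro h
      refine ⟨?_, .inl ⟨i, hi, v, hM.right_lt_of_memCode h, rfl, h⟩⟩
      have := hM.lt_of_memCode h
      exact this.trans_le (le_self_add.trans le_self_add)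
  have hnew : ∀ l, MemCode t' (mpair (n + 1) l) ↔ l = w := by
    intro l
    rw [ht']
    constructor
    · rintro ⟨-, ⟨j, hj, l, -, h, -⟩ | h⟩
      · rw [hM.mpair_inj] at h
        exact absurd hj (h.1 ▸ lt_irrefl _)
      · rw [hM.mpair_inj] at h
        exact h.2
    · rintro rfl
      exact ⟨hM.lt_add_one_iff.2 le_add_self, .inr rfl⟩
  refine ⟨t', ⟨(hold 0 m (by positivity)).2 h.1, ?_, ?_⟩, (hnew w).2 rfl⟩
  · intro i hi l _ l' _ h1 h2
    rcases (hM.lt_add_one_iff.1 hi).lt_or_eq with hi | rfl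
    · rw [hold i _ hi] at h1 h2
      exact h.2.1 i hi l (hM.right_lt_of_memCode h1) l' (hM.right_lt_of_memCode h2) h1 h2
    · rw [(hnew l).1 h1, (hnew l').1 h2]
  · intro i hi l _ h1
    rw [hold i _ hi] at h1
    rcases (hM.lt_add_one_iff.1 hi).lt_or_eq with hi' | rfl
    · obtain ⟨l', _, h3, h4⟩ := h.2.2 i hi' l (hM.right_lt_of_memCode h1) h1
      have h5 := (hold (i + 1) l' (by gcongr)).2 h4
      exact ⟨l', hM.right_lt_of_memCode h5, h3, h5⟩
    · have h5 := (hnew w).2 rfl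
      rw [hM.eq_of_isRun hGu h h h1 hv]
      exact ⟨w, hM.right_lt_of_memCode h5, hG, h5⟩

theorem IsModel.exists_isRun (hM : IsModel M V) {G : M → M → Prop}
    (hG : IsBounded V fun e : ℕ → M => G (e 0) (e 1)) (hGe : ∀ v, ∃ w, G v w)
    (hGu : ∀ v w w', G v w → G v w' → w = w') (m n : M) : ∃ t, IsRun G m t n := by
  refine hM.sigma_induction (P := fun n t => IsRun G m t n) (hM.isBounded_isRun hG m _ _) ?_ ?_ n
  · obtain ⟨t, ht⟩ := hM.exists_code (P := fun u => u = mpair 0 m) inferInstance (mpair 0 m + 1)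
    refine ⟨t, (ht _).2 ⟨lt_add_one _, rfl⟩, fun i _ v _ w _ h1 h2 => ?_,
      fun i hi => absurd hi _root_.not_lt_zero⟩
    have h3 := ((ht _).1 h1).2.trans ((ht _).1 h2).2.symm
    exact (hM.mpair_inj.1 h3).2
  · rintro n ⟨t, ht⟩
    obtain ⟨v, -, hv, -⟩ := hM.exists_common_of_isRun hGu ht ht
    obtain ⟨w, hw⟩ := hGe v
    obtain ⟨t', ht', -⟩ := hM.exists_isRun_add_one hGu ht hv hw
    exact ⟨t', ht'⟩

/-- A function with bounded graph can be iterated. -/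
theorem IsModel.exists_iterate (hM : IsModel M V) {G : M → M → Prop}
    (hG : IsBounded V fun e : ℕ → M => G (e 0) (e 1)) (hGe : ∀ v, ∃ w, G v w)
    (hGu : ∀ v w w', G v w → G v w' → w = w') (m : M) :
    ∃ (f : M → M) (F : V), f 0 = m ∧ (∀ n, G (f n) (f (n + 1))) ∧
      ∀ n v, mpair n v ∈ F ↔ f n = v := by
  have hc := hM.isBounded_memCode
  have hr := hM.isBounded_isRun hG m
  -- The choices of `T` and `f` are external to the model; only the set `F` makes `f` available to
  -- induction and comprehension.
  choose T hT using hM.exists_isRun hG hGe hGu m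
  have hf : ∀ n, ∃ v, MemCode (T n) (mpair n v) := by
    intro n
    obtain ⟨v, -, hv, -⟩ := hM.exists_common_of_isRun hGu (hT n) (hT n)
    exact ⟨v, hv⟩
  choose f hf using hf
  have huniq : ∀ {t n v}, IsRun G m t n → (MemCode t (mpair n v) ↔ f n = v) := by
    intro t n v ht
    constructor
    · exact fun h => hM.eq_of_isRun hGu (hT n) ht (hf n) h
    · rintro rfl
      obtain ⟨v, -, h1, h2⟩ := hM.exists_common_of_isRun hGu (hT n) ht
      rwa [hM.eq_of_isRun hGu (hT n) (hT n) (hf n) h1]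
  -- The graph is Δ⁰₁: as runs agree at their last index, "some run to `n` contains the pair" and
  -- "every run to `n` contains it" coincide.
  obtain ⟨F, hF⟩ := hM.comprehension
    (P := fun z t => ∃ n, n < z + 1 ∧ ∃ v, v < z + 1 ∧ z = mpair n v ∧ IsRun G m t n ∧ MemCode t z)
    (Q := fun z t => ∃ n, n < z + 1 ∧ ∃ v, v < z + 1 ∧ z = mpair n v ∧
      (IsRun G m t n → MemCode t z)) inferInstance inferInstance (by
    intro z
    constructor
    · rintro ⟨t, n, hn, v, hv, rfl, h1, h2⟩ t'
      refine ⟨n, hn, v, hv, rfl, fun h => ?_⟩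
      rwa [huniq h, ← huniq h1]
    · intro h
      obtain ⟨n, hn, v, hv, rfl, -⟩ := h 0
      obtain ⟨n', -, v', -, h1, h2⟩ := h (T n)
      obtain ⟨rfl, rfl⟩ := hM.mpair_inj.1 h1
      exact ⟨T n, n, hn, v, hv, rfl, hT n, h2 (hT n)⟩)
  refine ⟨f, F, (huniq (hT 0)).1 (hT 0).1, fun n => ?_, fun n v => ?_⟩
  · obtain ⟨w, hw⟩ := hGe (f n)
    obtain ⟨t, ht, h⟩ := hM.exists_isRun_add_one hGu (hT n) (hf n) hw
    rwa [(huniq ht).1 h]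
  · rw [hF]
    constructor
    · rintro ⟨t, n', hn, v', hv, h, h1, h2⟩
      obtain ⟨rfl, rfl⟩ := hM.mpair_inj.1 h
      exact (huniq h1).1 h2
    · rintro rfl
      exact ⟨T n, n, hM.lt_add_one_iff.2 (left_le_mpair _ _), f n,
        hM.lt_add_one_iff.2 (hM.right_le_mpair _ _), rfl, hT n, hf n⟩

end OrderedSemiring

/-! ## The meaning of the formulas -/

section NamedVariables

variable {M V : Type} [Zero M] [One M] [Add M] [Mul M] [LT M] [Membership M V]

theorem sat_All (n : ℕ) (φ : Fm) (e : ℕ → M) (r : ℕ → V) :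
    (All n φ).Sat e r ↔ ∀ m, φ.Sat (Function.update e n m) r := by
  refine forall_congr' fun m => ?_
  rw [Fm.sat_subst]
  refine iff_of_eq (congrArg (fun f => φ.Sat f r) (funext fun i => ?_))
  by_cases h : i = n <;> simp [h, Tm.eval, consVar]

theorem sat_Ex (n : ℕ) (φ : Fm) (e : ℕ → M) (r : ℕ → V) :
    (Ex n φ).Sat e r ↔ ∃ m, φ.Sat (Function.update e n m) r := by
  simp [Ex, Fm.sat_neg, sat_All]

theorem sat_AllSet (n : ℕ) (φ : Fm) (e : ℕ → M) (r : ℕ → V) :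
    (AllSet n φ).Sat e r ↔ ∀ A, φ.Sat e (Function.update r n A) := by
  refine forall_congr' fun A => ?_
  rw [Fm.sat_subst]
  refine iff_of_eq (congrArg (fun f => φ.Sat e f) (funext fun i => ?_))
  by_cases h : i = n <;> simp [h, consVar]

theorem sat_ExSet (n : ℕ) (φ : Fm) (e : ℕ → M) (r : ℕ → V) :
    (ExSet n φ).Sat e r ↔ ∃ A, φ.Sat e (Function.update r n A) := by
  simp [ExSet, Fm.sat_neg, sat_AllSet]

theorem sat_AllList (l : List ℕ) (φ : Fm) (r : ℕ → V) : ∀ e : ℕ → M,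
    (AllList l φ).Sat e r ↔ ∀ v : ℕ → M, φ.Sat (fun i => if i ∈ l then v i else e i) r := by
  induction l with
  | nil => intro e; simp [AllList]
  | cons n l ih =>
    intro e
    change (All n (AllList l φ)).Sat e r ↔ _
    simp only [sat_All, ih]
    constructor
    · intro h v
      convert h (v n) v using 2 with i
      by_cases h1 : i ∈ l <;> by_cases h2 : i = n <;> simp [h1, h2]
    · intro h m v
      convert h (fun i => if i ∈ l then v i else m) using 2 with i
      by_cases h1 : i ∈ l <;> by_cases h2 : i = n <;> simp [h1, h2]

theorem sat_ExList (l : List ℕ) (φ : Fm) (e : ℕ → M) (r : ℕ → V) :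
    (ExList l φ).Sat e r ↔ ∃ v : ℕ → M, φ.Sat (fun i => if i ∈ l then v i else e i) r := by
  have : (ExList l φ).Sat e r ↔ ¬ (AllList l φ.neg).Sat e r := by
    induction l generalizing e with
    | nil => simp [ExList, AllList, Fm.sat_neg]
    | cons n l ih =>
      change (Ex n (ExList l φ)).Sat e r ↔ ¬ (All n (AllList l φ.neg)).Sat e r
      simp [sat_Ex, sat_All, ih]
  simp [this, sat_AllList, Fm.sat_neg]

theorem sat_conj (l : List Fm) (e : ℕ → M) (r : ℕ → V) :
    (conj l).Sat e r ↔ ∀ φ ∈ l, φ.Sat e r := by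
  induction l with
  | nil => simp [conj, Fm.sat_tru]
  | cons φ l ih =>
    change (φ ⋏ conj l).Sat e r ↔ _
    simp [Fm.sat_and, ih]

theorem sat_increasing (l : List ℕ) (e : ℕ → M) (r : ℕ → V) :
    (increasing l).Sat e r ↔ (l.map e).IsChain (· < ·) := by
  induction l with
  | nil => simp [increasing, Fm.sat_tru]
  | cons n l ih =>
    cases l with
    | nil => simp [increasing, Fm.sat_tru]
    | cons m l => simp [increasing, Fm.sat_and, ih, Fm.Sat, Tm.eval]

/-- The environment with the values `f` for the names `x₀, …, xₙ₋₁`. -/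
def setX (n : ℕ) (f e : ℕ → M) (i : ℕ) : M := if i ∈ xs n then f ((i - 10) / 2) else e i

/-- The environment with the values `f` for the names `y₀, …, yₙ₋₁`. -/
def setY (n : ℕ) (f e : ℕ → M) (i : ℕ) : M := if i ∈ ys n then f ((i - 11) / 2) else e i

theorem mem_xs {n i : ℕ} : i ∈ xs n ↔ ∃ l < n, 10 + 2 * l = i := by simp [xs]

theorem mem_ys {n i : ℕ} : i ∈ ys n ↔ ∃ l < n, 11 + 2 * l = i := by simp [ys]

theorem sat_AllList_xs (n : ℕ) (φ : Fm) (e : ℕ → M) (r : ℕ → V) :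
    (AllList (xs n) φ).Sat e r ↔ ∀ f : ℕ → M, φ.Sat (setX n f e) r := by
  rw [sat_AllList]
  refine ⟨fun h f => h fun i => f ((i - 10) / 2), fun h v => ?_⟩
  convert h fun i => v (10 + 2 * i) using 2 with i
  unfold setX
  split_ifs with hi
  · obtain ⟨l, -, rfl⟩ := mem_xs.1 hi
    congr 1; omega
  · rfl

theorem sat_ExList_xs (n : ℕ) (φ : Fm) (e : ℕ → M) (r : ℕ → V) :
    (ExList (xs n) φ).Sat e r ↔ ∃ f : ℕ → M, φ.Sat (setX n f e) r := by
  rw [sat_ExList]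
  refine ⟨fun ⟨v, h⟩ => ⟨fun i => v (10 + 2 * i), ?_⟩, fun ⟨f, h⟩ => ⟨fun i => f ((i - 10) / 2), h⟩⟩
  convert h using 2 with i
  unfold setX
  split_ifs with hi
  · obtain ⟨l, -, rfl⟩ := mem_xs.1 hi
    congr 1; omega
  · rfl

theorem sat_AllList_ys (n : ℕ) (φ : Fm) (e : ℕ → M) (r : ℕ → V) :
    (AllList (ys n) φ).Sat e r ↔ ∀ f : ℕ → M, φ.Sat (setY n f e) r := by
  rw [sat_AllList]
  refine ⟨fun h f => h fun i => f ((i - 11) / 2), fun h v => ?_⟩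
  convert h fun i => v (11 + 2 * i) using 2 with i
  unfold setY
  split_ifs with hi
  · obtain ⟨l, -, rfl⟩ := mem_ys.1 hi
    congr 1; omega
  · rfl

theorem sat_ExList_ys (n : ℕ) (φ : Fm) (e : ℕ → M) (r : ℕ → V) :
    (ExList (ys n) φ).Sat e r ↔ ∃ f : ℕ → M, φ.Sat (setY n f e) r := by
  rw [sat_ExList]
  refine ⟨fun ⟨v, h⟩ => ⟨fun i => v (11 + 2 * i), ?_⟩, fun ⟨f, h⟩ => ⟨fun i => f ((i - 11) / 2), h⟩⟩
  convert h using 2 with i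
  unfold setY
  split_ifs with hi
  · obtain ⟨l, -, rfl⟩ := mem_ys.1 hi
    congr 1; omega
  · rfl

theorem setX_x {n l : ℕ} (f e : ℕ → M) (h : l < n) : setX n f e (x l) = f l := by
  rw [setX, if_pos (mem_xs.2 ⟨l, h, rfl⟩)]
  congr 1
  change (10 + 2 * l - 10) / 2 = l
  omega

theorem setY_y {n l : ℕ} (f e : ℕ → M) (h : l < n) : setY n f e (y l) = f l := by
  rw [setY, if_pos (mem_ys.2 ⟨l, h, rfl⟩)]
  congr 1
  change (11 + 2 * l - 11) / 2 = l
  omega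

theorem setX_of_lt {n i : ℕ} (f e : ℕ → M) (h : i < 10) : setX n f e i = e i := by
  refine if_neg fun hi => ?_
  obtain ⟨l, -, rfl⟩ := mem_xs.1 hi
  omega

theorem setY_of_lt {n i : ℕ} (f e : ℕ → M) (h : i < 10) : setY n f e i = e i := by
  refine if_neg fun hi => ?_
  obtain ⟨l, -, rfl⟩ := mem_ys.1 hi
  omega

theorem setY_x {n l : ℕ} (f e : ℕ → M) : setY n f e (x l) = e (x l) := by
  refine if_neg fun hi => ?_
  obtain ⟨i, -, hi⟩ := mem_ys.1 hi
  have : 11 + 2 * i = 10 + 2 * l := hi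
  omega

end NamedVariables

/-! ### Coded tuples and the semantic content of the three principles -/

section Tuples

variable {M V : Type} [CommSemiring M] [LinearOrder M] [Membership M V]

/-- Codes of tuples. -/
def mtuple : List M → M
  | [] => 0
  | [m] => m
  | m :: n :: l => mpair m (mtuple (n :: l))

theorem eval_tuple (l : List Tm) (e : ℕ → M) : (tuple l).eval e = mtuple (l.map (Tm.eval e)) := by
  induction l with
  | nil => rfl
  | cons s l ih =>
    cases l with
    | nil => rfl
    | cons t l =>
      change mpair (s.eval e) ((tuple (t :: l)).eval e) = _
      rw [ih]; rfl

/-- The code of the tuple of the first `n` members of a sequence. -/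
def tup (n : ℕ) (f : ℕ → M) : M := mtuple ((List.range n).map f)

theorem tup_congr {n : ℕ} {f g : ℕ → M} (h : ∀ i < n, f i = g i) : tup n f = tup n g := by
  unfold tup
  congr 1
  exact List.map_congr_left fun i hi => h i (List.mem_range.1 hi)

/-- The first `n` members of the sequence `f` are strictly increasing. -/
def Inc (n : ℕ) (f : ℕ → M) : Prop := ∀ i, i + 1 < n → f i < f (i + 1)

theorem isChain_map_range (n : ℕ) (f : ℕ → M) :
    ((List.range n).map f).IsChain (· < ·) ↔ Inc n f := by
  simp [List.isChain_iff_getElem, Inc]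

theorem isChain_map_range_tail (n : ℕ) (f : ℕ → M) :
    (((List.range (n + 1)).map f).tail).IsChain (· < ·) ↔ Inc n fun i => f (i + 1) := by
  simp [List.isChain_iff_getElem, Inc]

/-- `C` is a function from the `n`-tuples with property `D` to the numbers below `k`. -/
def IsColouring (n : ℕ) (D : (ℕ → M) → Prop) (k : M) (C : V) : Prop :=
  (∀ z, z ∈ C → ∃ (f : ℕ → M) (j : M), D f ∧ j < k ∧ z = mpair (tup n f) j) ∧
  ∀ f : ℕ → M, D f → ∃ j, j < k ∧ mpair (tup n f) j ∈ C ∧ ∀ j', mpair (tup n f) j' ∈ C → j' = j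

/-- `E` is the graph of the increasing enumeration of `X`. -/
def IsEnum (X E : V) : Prop :=
  ((∀ z : M, z ∈ E → ∃ m v, z = mpair m v) ∧
    ∀ m : M, ∃ v, mpair m v ∈ E ∧ ∀ v', mpair m v' ∈ E → v' = v) ∧
  (∀ m n v w : M, m < n → mpair m v ∈ E → mpair n w ∈ E → v < w) ∧
  ∀ v : M, v ∈ X ↔ ∃ m, mpair m v ∈ E

/-- `S` is the graph of the function of adjacent sums of the function with graph `E`. -/
def IsSums (E S : V) : Prop :=
  ((∀ z : M, z ∈ S → ∃ m n v, m ≤ n ∧ z = mpair (mpair m n) v) ∧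
    ∀ m n : M, m ≤ n → ∃ v, mpair (mpair m n) v ∈ S ∧ ∀ v', mpair (mpair m n) v' ∈ S → v' = v) ∧
  (∀ m v : M, mpair (mpair m m) v ∈ S ↔ mpair m v ∈ E) ∧
  ∀ m n v w : M, m ≤ n → mpair (mpair m n) v ∈ S → mpair (n + 1) w ∈ E →
    mpair (mpair m (n + 1)) (v + w) ∈ S

variable (M V) in
/-- The meaning of `ZRT`. -/
def ZRTHolds (n : ℕ) : Prop :=
  ∀ (C : V) (k : M), IsColouring n (Inc n) k C →
    (∀ (f : ℕ → M) (z j : M), Inc n f →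
      (mpair (tup n f) j ∈ C ↔ mpair (tup n fun i => f i + z) j ∈ C)) →
    ∃ X : V, (∀ m : M, ∃ n, m < n ∧ n ∈ X) ∧
      ∃ c : M, ∀ f : ℕ → M, Inc n f → (∀ i < n, f i ∈ X) → mpair (tup n f) c ∈ C

/-- The places at which adjacent sums start. -/
def startAt (f : ℕ → M) : ℕ → M
  | 0 => f 0
  | i + 1 => f (i + 1) + 1

variable (M V) in
/-- The meaning of `AHTd`. -/
def AHTdHolds (d : ℕ) : Prop :=
  ∀ (C : V) (k : M), IsColouring d (fun _ => True) k C →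
    ∃ X : V, (∀ m : M, ∃ n, m < n ∧ n ∈ X) ∧ ∃ E : V, IsEnum X E ∧ ∃ S : V, IsSums E S ∧
      ∃ c : M, ∀ f g : ℕ → M, f 0 ≤ f 1 → (Inc d fun i => f (i + 1)) →
        (∀ i < d, mpair (mpair (startAt f i) (f (i + 1))) (g i) ∈ S) → mpair (tup d g) c ∈ C

variable (M V) in
/-- The meaning of `AHT`. -/
def AHTHolds : Prop :=
  ∀ (C : V) (k : M), IsColouring 1 (fun _ => True) k C →
    ∃ X : V, (∀ m : M, ∃ n, m < n ∧ n ∈ X) ∧ ∃ E : V, IsEnum X E ∧ ∃ S : V, IsSums E S ∧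
      ∃ c : M, ∀ m n v : M, mpair (mpair m (m + n)) v ∈ S → mpair v c ∈ C

theorem names_lt : c < 10 ∧ j < 10 ∧ j' < 10 ∧ z < 10 := by decide

theorem update_x {i l : ℕ} (h : i < 10) (e : ℕ → M) (m : M) :
    Function.update e i m (x l) = e (x l) :=
  Function.update_of_ne (show 10 + 2 * l ≠ i by omega) _ _

theorem update_y {i l : ℕ} (h : i < 10) (e : ℕ → M) (m : M) :
    Function.update e i m (y l) = e (y l) :=
  Function.update_of_ne (show 11 + 2 * l ≠ i by omega) _ _

theorem eval_tuple_xs (n : ℕ) (e : ℕ → M) :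
    (tuple ((xs n).map .var)).eval e = tup n fun i => e (x i) := by
  rw [eval_tuple, xs, List.map_map, List.map_map]; rfl

theorem eval_tuple_ys (n : ℕ) (e : ℕ → M) :
    (tuple ((ys n).map .var)).eval e = tup n fun i => e (y i) := by
  rw [eval_tuple, ys, List.map_map, List.map_map]; rfl

theorem eval_tuple_xs_add (n l : ℕ) (e : ℕ → M) :
    (tuple ((xs n).map fun i => .add (.var i) (.var l))).eval e =
      tup n fun i => e (x i) + e l := by
  rw [eval_tuple, xs, List.map_map, List.map_map]; rfl

theorem sat_increasing_xs (n : ℕ) (e : ℕ → M) (r : ℕ → V) :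
    (increasing (xs n)).Sat e r ↔ Inc n fun i => e (x i) := by
  rw [sat_increasing, xs, List.map_map, isChain_map_range]; rfl

theorem sat_increasing_xs_tail (n : ℕ) (e : ℕ → M) (r : ℕ → V) :
    (increasing (xs (n + 1)).tail).Sat e r ↔ Inc n fun i => e (x (i + 1)) := by
  rw [sat_increasing, xs, ← List.map_tail, List.map_map, List.map_tail, isChain_map_range_tail]; rfl

theorem inc_setX (n : ℕ) (f e : ℕ → M) : Inc n (fun i => setX n f e (x i)) ↔ Inc n f := by
  refine forall_congr' fun i => imp_congr_right fun hi => ?_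
  beta_reduce
  rw [setX_x f e hi, setX_x f e (by omega)]

theorem inc_setX_succ (n : ℕ) (f e : ℕ → M) :
    Inc n (fun i => setX (n + 1) f e (x (i + 1))) ↔ Inc n fun i => f (i + 1) := by
  refine forall_congr' fun i => imp_congr_right fun hi => ?_
  beta_reduce
  rw [setX_x f e (by omega), setX_x f e (by omega)]

theorem tup_setX (n : ℕ) (f e : ℕ → M) : tup n (fun i => setX n f e (x i)) = tup n f :=
  tup_congr fun _ hi => setX_x f e hi

theorem tup_setX_add (n : ℕ) (f e : ℕ → M) (m : M) :
    tup n (fun i => setX n f e (x i) + m) = tup n fun i => f i + m :=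
  tup_congr fun _ hi => by rw [setX_x f e hi]

theorem tup_setY (n : ℕ) (f e : ℕ → M) : tup n (fun i => setY n f e (y i)) = tup n f :=
  tup_congr fun _ hi => setY_y f e hi

theorem eval_pair (s t : Tm) (e : ℕ → M) : (pair s t).eval e = mpair (s.eval e) (t.eval e) := rfl

theorem sat_app (F : ℕ) (l : List Tm) (t : Tm) (e : ℕ → M) (r : ℕ → V) :
    (app F l t).Sat e r ↔ mpair ((tuple l).eval e) (t.eval e) ∈ r F := Iff.rfl

theorem sat_eq (s t : Tm) (e : ℕ → M) (r : ℕ → V) :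
    (Fm.eq s t).Sat e r ↔ s.eval e = t.eval e := Iff.rfl

theorem sat_lt (s t : Tm) (e : ℕ → M) (r : ℕ → V) :
    (Fm.lt s t).Sat e r ↔ s.eval e < t.eval e := Iff.rfl

theorem sat_mem (t : Tm) (F : ℕ) (e : ℕ → M) (r : ℕ → V) :
    (Fm.mem t F).Sat e r ↔ t.eval e ∈ r F := Iff.rfl

theorem sat_le (s t : Tm) (e : ℕ → M) (r : ℕ → V) :
    (le s t).Sat e r ↔ s.eval e ≤ t.eval e := by
  rw [le, Fm.sat_or, sat_lt, sat_eq, le_iff_lt_or_eq]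

theorem sat_isColouringOfSubsets (n : ℕ) (e : ℕ → M) (r : ℕ → V) :
    (isColouringOfSubsets n).Sat e r ↔ IsColouring n (Inc n) (e k) (r C) := by
  simp [isColouringOfSubsets, isFunction, IsColouring, Fm.sat_and, sat_All, sat_Ex, Fm.sat_imp,
    sat_ExList_xs, sat_AllList_xs, sat_increasing_xs, sat_lt, sat_eq, sat_mem, sat_app, eval_pair,
    eval_tuple_xs, update_x, names_lt, inc_setX, tup_setX, setX_of_lt, Tm.eval]

theorem sat_isColouringOfTuples (n : ℕ) (e : ℕ → M) (r : ℕ → V) :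
    (isColouringOfTuples n).Sat e r ↔ IsColouring n (fun _ => True) (e k) (r C) := by
  simp [isColouringOfTuples, isFunction, IsColouring, Fm.sat_and, sat_All, sat_Ex, Fm.sat_imp,
    sat_ExList_ys, sat_AllList_ys, Fm.sat_tru, sat_lt, sat_eq, sat_mem, sat_app, eval_pair,
    eval_tuple_ys, update_y, names_lt, tup_setY, setY_of_lt, Tm.eval]

/-- A 1-tuple is coded by its entry, so this colouring of numbers has the same meaning as a
colouring of 1-tuples. -/
theorem sat_isFunction_u (e : ℕ → M) (r : ℕ → V) :
    (isFunction C [u] .tru (.lt (.var j) (.var k))).Sat e r ↔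
      IsColouring 1 (fun _ => True) (e k) (r C) := by
  have h1 : ∀ f : ℕ → M, tup 1 f = f 0 := fun f => rfl
  have h2 : ∀ p : M → Prop, (∀ f : ℕ → M, p (f 0)) ↔ ∀ m, p m :=
    fun p => ⟨fun h m => h fun _ => m, fun h f => h (f 0)⟩
  have h3 : ∀ p : M → Prop, (∃ f : ℕ → M, p (f 0)) ↔ ∃ m, p m :=
    fun p => ⟨fun ⟨f, h⟩ => ⟨f 0, h⟩, fun ⟨m, h⟩ => ⟨fun _ => m, h⟩⟩
  simp [isFunction, IsColouring, Fm.sat_and, sat_All, sat_Ex, Fm.sat_imp, ExList, AllList,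
    Fm.sat_tru, sat_lt, sat_eq, sat_mem, sat_app, eval_pair, tuple, Tm.eval, h1]
  exact and_congr (forall₂_congr fun z _ => (h3 fun m => ∃ j < e k, z = mpair m j).symm)
    (h2 fun m => ∃ j < e k, mpair m j ∈ r C ∧ ∀ j', mpair m j' ∈ r C → j' = j).symm

theorem sat_isInvariant (n : ℕ) (e : ℕ → M) (r : ℕ → V) :
    (isInvariant n).Sat e r ↔ ∀ (f : ℕ → M) (z j : M), Inc n f →
      (mpair (tup n f) j ∈ r C ↔ mpair (tup n fun i => f i + z) j ∈ r C) := by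
  simp [isInvariant, sat_All, Fm.sat_imp, Fm.sat_iff, sat_AllList_xs, sat_increasing_xs, sat_app,
    eval_tuple_xs, eval_tuple_xs_add, update_x, names_lt, inc_setX, tup_setX, tup_setX_add,
    Tm.eval]

theorem sat_infinite (F : ℕ) (e : ℕ → M) (r : ℕ → V) :
    (infinite F).Sat e r ↔ ∀ m : M, ∃ n, m < n ∧ n ∈ r F := by
  simp [infinite, sat_All, sat_Ex, Fm.sat_and, sat_lt, sat_mem, Tm.eval]

theorem sat_isHomogeneous (n : ℕ) (e : ℕ → M) (r : ℕ → V) :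
    (isHomogeneous n).Sat e r ↔ ∃ c : M, ∀ f : ℕ → M, Inc n f → (∀ i < n, f i ∈ r X) →
      mpair (tup n f) c ∈ r C := by
  have h : ∀ f e : ℕ → M, (∀ i < n, setX n f e (x i) ∈ r X) ↔ ∀ i < n, f i ∈ r X := fun f e =>
    forall_congr' fun i => imp_congr_right fun hi => by rw [setX_x f e hi]
  have h' : ∀ e : ℕ → M, (conj ((xs n).map fun i => .mem (.var i) X)).Sat e r ↔
      ∀ i < n, e (x i) ∈ r X := by
    intro e
    simp only [sat_conj, xs, List.map_map, List.forall_mem_map, List.mem_range]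
    rfl
  simp only [isHomogeneous, sat_Ex, Fm.sat_imp, Fm.sat_and, sat_AllList_xs, sat_increasing_xs,
    sat_app, eval_tuple_xs, h', h, inc_setX, tup_setX, Tm.eval, and_imp]
  simp [setX_of_lt]

theorem sat_ZRT (n : ℕ) (e : ℕ → M) (r : ℕ → V) : (ZRT n).Sat e r ↔ ZRTHolds M V n := by
  simp [ZRT, ZRTHolds, sat_AllSet, sat_ExSet, sat_All, Fm.sat_imp, Fm.sat_and,
    sat_isColouringOfSubsets, sat_isInvariant, sat_infinite, sat_isHomogeneous]

theorem sat_isEnumeration (e : ℕ → M) (r : ℕ → V) :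
    isEnumeration.Sat e r ↔ IsEnum (M := M) (r X) (r E) := by
  simp [isEnumeration, IsEnum, isFunction, ExList, AllList, sat_All, sat_Ex, Fm.sat_imp,
    Fm.sat_and, Fm.sat_iff, Fm.sat_tru, sat_app, sat_eq, sat_mem, sat_lt, eval_pair, tuple, Tm.eval]

theorem sat_isAdjacentSums (e : ℕ → M) (r : ℕ → V) :
    isAdjacentSums.Sat e r ↔ IsSums (M := M) (r E) (r S) := by
  simp [isAdjacentSums, IsSums, isFunction, ExList, AllList, sat_All, sat_Ex, Fm.sat_imp,
    Fm.sat_and, Fm.sat_iff, Fm.sat_tru, sat_app, sat_eq, sat_mem, sat_le, eval_pair, tuple, Tm.eval]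

/-- `1 ≤ d` ensures that `x 1` is among the quantified names. -/
theorem sat_isAdjacentTuple (d : ℕ) (hd : 1 ≤ d) (f g e : ℕ → M) (r : ℕ → V) :
    (isAdjacentTuple d).Sat (setY d g (setX (d + 1) f e)) r ↔
      f 0 ≤ f 1 ∧ (Inc d fun i => f (i + 1)) ∧
        ∀ i < d, mpair (mpair (startAt f i) (f (i + 1))) (g i) ∈ r S := by
  have h : ∀ i ≤ d, setY d g (setX (d + 1) f e) (x i) = f i := fun i hi => by
    rw [setY_x, setX_x f e (by omega)]
  have hstart : ∀ i < d, (start i).eval (setY d g (setX (d + 1) f e)) = startAt f i := by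
    intro i hi
    cases i with
    | zero => exact h 0 (by omega)
    | succ i => simp only [start, Tm.eval, startAt, h (i + 1) hi.le]
  rw [isAdjacentTuple, Fm.sat_and, Fm.sat_and, sat_le, sat_increasing_xs_tail]
  simp only [Tm.eval, h 0 (by omega), h 1 hd, setY_x, inc_setX_succ, sat_conj,
    List.forall_mem_map, List.mem_range]
  refine and_congr_right fun _ => and_congr_right fun _ => forall_congr' fun i =>
    imp_congr_right fun hi => ?_
  simp only [sat_app, tuple, eval_pair, hstart i hi, Tm.eval, h (i + 1) hi, setY_y g _ hi]

theorem sat_AHTd (d : ℕ) (hd : 1 ≤ d) (e : ℕ → M) (r : ℕ → V) :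
    (AHTd d).Sat e r ↔ AHTdHolds M V d := by
  simp [AHTd, AHTdHolds, sat_AllSet, sat_ExSet, sat_All, sat_Ex, Fm.sat_imp, Fm.sat_and,
    sat_isColouringOfTuples, sat_infinite, sat_isEnumeration, sat_isAdjacentSums, sat_AllList_xs,
    sat_AllList_ys, sat_isAdjacentTuple d hd, sat_app, eval_tuple_ys, tup_setY, setX_of_lt,
    setY_of_lt, Tm.eval]

theorem sat_AHT (e : ℕ → M) (r : ℕ → V) : AHT.Sat e r ↔ AHTHolds M V := by
  simp [AHT, AHTHolds, sat_AllSet, sat_ExSet, sat_All, sat_Ex, Fm.sat_imp, Fm.sat_and,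
    sat_isFunction_u, sat_infinite, sat_isEnumeration, sat_isAdjacentSums, sat_app, tuple,
    eval_pair, Tm.eval]

end Tuples

section Equivalence

variable {M V : Type} [CommSemiring M] [LinearOrder M] [IsStrictOrderedRing M]
  [CanonicallyOrderedAdd M] [Membership M V] [Nonempty V]

/-! ## Tuples in models -/

theorem IsModel.mtuple_inj (hM : IsModel M V) : ∀ l l' : List M, l.length = l'.length →
    mtuple l = mtuple l' → l = l'
  | [], [], _, _ => rfl
  | [_], [_], _, h => congrArg (fun m => [m]) h
  | m :: n :: l, m' :: n' :: l', hl, h => by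
    obtain ⟨h1, h2⟩ := hM.mpair_inj.1 h
    rw [h1, IsModel.mtuple_inj hM (n :: l) (n' :: l') (by simpa using hl) h2]

theorem IsModel.tup_inj (hM : IsModel M V) {n : ℕ} {f g : ℕ → M} (h : tup n f = tup n g) :
    ∀ i < n, f i = g i := by
  have := hM.mtuple_inj _ _ (by simp) h
  exact fun i hi => List.map_inj_left.1 this i (List.mem_range.2 hi)

theorem IsModel.le_mtuple (hM : IsModel M V) : ∀ (l : List M), ∀ m ∈ l, m ≤ mtuple l
  | [], m, h => by simp at h
  | [n], m, h => by rw [List.mem_singleton.1 h]; rfl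
  | n :: n' :: l, m, h => by
    rcases List.mem_cons.1 h with rfl | h
    · exact left_le_mpair _ _
    · exact (IsModel.le_mtuple hM (n' :: l) m h).trans (hM.right_le_mpair _ _)

/-- Supplies the bounds for quantifiers over the entries of a coded tuple. -/
theorem IsModel.le_tup (hM : IsModel M V) {n i : ℕ} (f : ℕ → M) (hi : i < n) : f i ≤ tup n f :=
  hM.le_mtuple _ _ (List.mem_map_of_mem (List.mem_range.2 hi))

instance IsTerm.tup (n : ℕ) (t : (ℕ → M) → ℕ → M) [h : ∀ i, IsTerm fun e => t e i] :
    IsTerm fun e => tup n (t e) := by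
  have key : ∀ l : List ℕ, IsTerm fun e => mtuple (l.map (t e)) := by
    intro l
    induction l with
    | nil => exact IsTerm.const 0
    | cons i l ih =>
      cases l with
      | nil => exact h i
      | cons j l =>
        exact (inferInstance : IsTerm fun e => SOA.mpair (t e i) (mtuple ((j :: l).map (t e))))
  exact key _

instance IsTerm.tup_var (n : ℕ) : IsTerm fun e : ℕ → M => SOA.tup n e :=
  IsTerm.tup n fun e i => e i

instance IsTerm.sum_range (n : ℕ) (t : (ℕ → M) → ℕ → M) [h : ∀ i, IsTerm fun e => t e i] :
    IsTerm fun e => ∑ i ∈ Finset.range n, t e i := by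
  induction n with
  | zero => simpa using IsTerm.const (0 : M)
  | succ n ih =>
    simp only [Finset.sum_range_succ]
    infer_instance

/-- Here `n` is standard, so this is a finite conjunction and not a quantifier of the language. -/
instance IsBounded.forall_lt_nat (n : ℕ) (P : ℕ → (ℕ → M) → Prop) [h : ∀ i, IsBounded V (P i)] :
    IsBounded V fun e => ∀ i, i < n → P i e := by
  induction n with
  | zero => exact (IsBounded.prop True).congr fun e => by simp
  | succ n ih =>
    exact (inferInstance : IsBounded V fun e => (∀ i, i < n → P i e) ∧ P n e).congr
      fun e => Nat.forall_lt_succ_right.symm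

/-- Bounded quantification over the first `n` variables. -/
theorem IsBounded.bex_block (n : ℕ) : ∀ {Q : (ℕ → M) → Prop} {t : (ℕ → M) → M},
    IsBounded V Q → IsTerm t → IsBounded V fun e => ∃ v : ℕ → M, (∀ i < n, v i < t e) ∧
      Q fun i => if i < n then v i else e (i - n) := by
  induction n with
  | zero => exact fun hQ _ => hQ.congr fun e => by simp
  | succ n ih =>
    intro Q t hQ ht
    have h := ih hQ (ht.rename (· + 1))
    have h' : IsBounded V fun e => ∃ v : ℕ → M, (∀ i < n, v i < t fun i => e (i + 1)) ∧
        Q fun i => if i < n then v i else consVar (e 0) (fun i => e (i + 1)) (i - n) :=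
      h.congr fun e => by simp only [consVar_zero_succ]
    -- The newly quantified number becomes entry `n` of the block; the block from the induction
    -- hypothesis provides the entries below `n`.
    refine (IsBounded.bex (t := t) (ht := ht) (P := fun e m => ∃ v : ℕ → M, (∀ i < n, v i < t e) ∧
      Q fun i => if i < n then v i else consVar m e (i - n)) (hP := h')).congr fun e => ?_
    constructor
    · rintro ⟨m, hm, v, hv, h⟩
      refine ⟨fun i => if i < n then v i else m, fun i hi => ?_, ?_⟩
      · beta_reduce
        split_ifs with h1
        · exact hv i h1
        · exact hm
      · convert h using 2 with i
        rcases lt_trichotomy i n with h1 | rfl | h1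
        · simp [h1, h1.trans (Nat.lt_succ_self n)]
        · simp [consVar]
        · obtain ⟨j, rfl⟩ := Nat.exists_eq_add_of_lt h1
          rw [if_neg (by omega), if_neg (by omega), show n + j + 1 - n = j + 1 by omega,
            show n + j + 1 - (n + 1) = j by omega]
          rfl
    · rintro ⟨v, hv, h⟩
      refine ⟨v n, hv n (by omega), v, fun i hi => hv i (by omega), ?_⟩
      convert h using 2 with i
      rcases lt_trichotomy i n with h1 | rfl | h1
      · simp [h1, h1.trans (Nat.lt_succ_self n)]
      · simp [consVar]
      · obtain ⟨j, rfl⟩ := Nat.exists_eq_add_of_lt h1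
        rw [if_neg (by omega), if_neg (by omega), show n + j + 1 - n = j + 1 by omega,
          show n + j + 1 - (n + 1) = j by omega]
        rfl

/-- Comprehension for a predicate with a bounded quantifier over `n`-tuples. -/
theorem IsModel.exists_set_of_tuples (hM : IsModel M V) (n : ℕ) {P : M → (ℕ → M) → Prop}
    (hP : IsBounded V fun e => P (e n) e)
    (hle : ∀ z v, P z v → ∀ i < n, v i ≤ z)
    (hcongr : ∀ z v v', (∀ i < n, v i = v' i) → P z v → P z v') :
    ∃ A : V, ∀ z, z ∈ A ↔ ∃ v, P z v := by
  have h := IsBounded.bex_block n hP (inferInstance : IsTerm fun e : ℕ → M => e 0 + 1)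
  refine hM.exists_set (P := fun z => ∃ v, P z v) (h.congr fun e => ?_)
  simp only [lt_irrefl, if_false, Nat.sub_self]
  constructor
  · rintro ⟨v, -, h⟩
    exact ⟨_, h⟩
  · rintro ⟨v, h⟩
    exact ⟨v, fun i hi => hM.lt_add_one_iff.2 (hle _ _ h i hi),
      hcongr _ _ _ (fun i hi => (if_pos hi).symm) h⟩

/-- Comprehension for sets of pairs. -/
theorem IsModel.exists_set_of_pairs (hM : IsModel M V) {P : M → M → Prop}
    (hP : IsBounded V fun e : ℕ → M => P (e 0) (e 1)) :
    ∃ A : V, (∀ z : M, z ∈ A → ∃ m n, z = mpair m n) ∧ ∀ m n : M, mpair m n ∈ A ↔ P m n := by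
  have hP' : ∀ (s t : (ℕ → M) → M) [IsTerm s] [IsTerm t], IsBounded V fun e => P (s e) (t e) :=
    fun s t _ _ => hP.comp₂ s t
  obtain ⟨A, hA⟩ := hM.exists_set
    (P := fun z => ∃ m, m < z + 1 ∧ ∃ n, n < z + 1 ∧ z = mpair m n ∧ P m n) inferInstance
  refine ⟨A, fun z hz => ?_, fun m n => ?_⟩
  · obtain ⟨m, -, n, -, h, -⟩ := (hA z).1 hz
    exact ⟨m, n, h⟩
  · rw [hA]
    constructor
    · rintro ⟨m', -, n', -, h, h'⟩
      obtain ⟨rfl, rfl⟩ := hM.mpair_inj.1 h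
      exact h'
    · exact fun h => ⟨m, hM.lt_add_one_iff.2 (left_le_mpair _ _), n,
        hM.lt_add_one_iff.2 (hM.right_le_mpair _ _), rfl, h⟩

theorem IsColouring.lt {n : ℕ} {D : (ℕ → M) → Prop} {k : M} {C : V} (hM : IsModel M V)
    (hC : IsColouring n D k C) {p j : M} (h : mpair p j ∈ C) : j < k := by
  obtain ⟨f, j', -, hj, h'⟩ := hC.1 _ h
  rwa [(hM.mpair_inj.1 h').2]

theorem exists_differences {d : ℕ} {f : ℕ → M} (h : Inc (d + 1) f) :
    ∃ g : ℕ → M, ∀ i < d, 0 < g i ∧ f (i + 1) = f i + g i := by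
  have : ∀ i, ∃ m, i < d → 0 < m ∧ f (i + 1) = f i + m := by
    intro i
    by_cases hi : i < d
    · have h1 := h i (by omega)
      obtain ⟨m, hm⟩ := exists_add_of_le h1.le
      refine ⟨m, fun _ => ⟨pos_iff_ne_zero.2 ?_, hm⟩⟩
      rintro rfl
      rw [add_zero] at hm
      exact h1.ne hm.symm
    · exact ⟨0, fun h => absurd h hi⟩
  choose g hg using this
  exact ⟨g, fun i hi => hg i hi⟩

theorem inc_of_differences {d : ℕ} {f g : ℕ → M} (h : ∀ i < d, 0 < g i ∧ f (i + 1) = f i + g i) :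
    Inc (d + 1) f := by
  intro i hi
  obtain ⟨h1, h2⟩ := h i (by omega)
  rw [h2]
  exact lt_add_of_pos_right _ h1

/-! ## From the Ramsey theorem to the Hindman theorem -/

/-- The colouring of increasing tuples by the colour of their differences. -/
theorem IsModel.exists_difference_colouring (hM : IsModel M V) (d : ℕ) (C : V) :
    ∃ A : V, (∀ z : M, z ∈ A → ∃ (f : ℕ → M) (j : M), Inc (d + 1) f ∧ z = mpair (tup (d + 1) f) j) ∧
      ∀ (f g : ℕ → M) (j : M), (∀ i < d, 0 < g i ∧ f (i + 1) = f i + g i) →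
        (mpair (tup (d + 1) f) j ∈ A ↔ mpair (tup d g) j ∈ C) := by
  -- One block `v` holds all unknowns: the tuple in entries 0 to d, its differences in entries d+1
  -- to 2d, and the colour in entry 2d+1.
  have key : ∃ A : V, ∀ z : M, z ∈ A ↔ ∃ v : ℕ → M,
      (∀ i, i < d → 0 < v (d + 1 + i) ∧ v (i + 1) = v i + v (d + 1 + i)) ∧
      z = mpair (tup (d + 1) v) (v (d + 1 + d)) ∧
      mpair (tup d fun i => v (d + 1 + i)) (v (d + 1 + d)) ∈ C := by
    refine hM.exists_set_of_tuples (d + 1 + d + 1) (by infer_instance) ?_ ?_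
    · rintro z v ⟨h1, h2, -⟩ i hi
      have h3 : ∀ i < d + 1, v i ≤ z := fun i hi =>
        (hM.le_tup v hi).trans (h2 ▸ left_le_mpair _ _)
      rcases lt_or_ge i (d + 1) with h4 | h4
      · exact h3 i h4
      · obtain ⟨l, rfl⟩ := Nat.exists_eq_add_of_le h4
        rcases Nat.lt_or_ge l d with h5 | h5
        · refine le_trans ?_ (h3 (l + 1) (by omega))
          rw [(h1 l h5).2]
          exact le_add_self
        · have : l = d := by omega
          rw [this, h2]
          exact hM.right_le_mpair _ _
    · rintro z v v' hv ⟨h1, h2, h3⟩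
      refine ⟨fun i hi => ?_, ?_, ?_⟩
      · rw [← hv _ (by omega), ← hv _ (by omega), ← hv _ (by omega)]
        exact h1 i hi
      · rw [← hv _ (by omega), ← tup_congr fun i hi => hv i (by omega)]
        exact h2
      · rw [← hv _ (by omega), ← tup_congr fun i hi => hv (d + 1 + i) (by omega)]
        exact h3
  obtain ⟨A, hA⟩ := key
  have hmem : ∀ z, z ∈ A ↔ ∃ (f g : ℕ → M) (j : M), (∀ i < d, 0 < g i ∧ f (i + 1) = f i + g i) ∧
      z = mpair (tup (d + 1) f) j ∧ mpair (tup d g) j ∈ C := by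
    intro z
    rw [hA]
    constructor
    · rintro ⟨v, h⟩
      exact ⟨v, fun i => v (d + 1 + i), v (d + 1 + d), h⟩
    · rintro ⟨f, g, j, h1, rfl, h2⟩
      let v : ℕ → M := fun i => if i < d + 1 then f i else
        if i = d + 1 + d then j else g (i - (d + 1))
      have hf : ∀ i < d + 1, v i = f i := fun i hi => if_pos hi
      have hj : v (d + 1 + d) = j := by
        change (if d + 1 + d < d + 1 then _ else _) = j
        rw [if_neg (by omega), if_pos rfl]
      have hg : ∀ i < d, v (d + 1 + i) = g i := fun i hi => by
        simp only [v]; rw [if_neg (by omega), if_neg (by omega)]; congr 1; omega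
      refine ⟨v, fun i hi => ?_, ?_, ?_⟩
      · rw [hf i (by omega), hf (i + 1) (by omega), hg i hi]
        exact h1 i hi
      · rw [hj, tup_congr hf]
      · rw [hj, tup_congr hg]; exact h2
  refine ⟨A, fun z hz => ?_, fun f g j h => ?_⟩
  · obtain ⟨f, g, j, h, hz, -⟩ := (hmem z).1 hz
    exact ⟨f, j, inc_of_differences h, hz⟩
  · rw [hmem]
    constructor
    · rintro ⟨f', g', j', h1, h2, h3⟩
      obtain ⟨h4, rfl⟩ := hM.mpair_inj.1 h2
      have h5 := hM.tup_inj h4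
      rwa [tup_congr (g := g') fun i hi => ?_]
      have h6 := (h i hi).2
      rw [h5 (i + 1) (by omega), h5 i (by omega), (h1 i hi).2] at h6
      exact (add_left_cancel h6).symm
    · exact fun h' => ⟨f, g, j, h, rfl, h'⟩

/-- Every infinite set has a sequence of members each more than twice as large as the one
before. -/
theorem IsModel.exists_sparse_sequence (hM : IsModel M V) {X : V}
    (hX : ∀ m : M, ∃ n, m < n ∧ n ∈ X) :
    ∃ (f : M → M) (F : V), (∀ n v, mpair n v ∈ F ↔ f n = v) ∧ (∀ n, f n ∈ X) ∧
      (∀ n, f n + f n < f (n + 1)) ∧ StrictMono f ∧ ∀ n, n ≤ f n := by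
  -- Taking the least element of `X` above twice the current value makes the step single-valued with
  -- a bounded graph, as the iteration requires.
  have hG : IsBounded V fun e : ℕ → M =>
      (e 0 + e 0 < e 1 ∧ e 1 ∈ X) ∧ ∀ u, u < e 1 → ¬ (e 0 + e 0 < u ∧ u ∈ X) := inferInstance
  obtain ⟨m, -, hm⟩ := hX 0
  have hGe : ∀ v : M, ∃ w, (v + v < w ∧ w ∈ X) ∧ ∀ u, u < w → ¬ (v + v < u ∧ u ∈ X) := by
    intro v
    obtain ⟨n, hn⟩ := hX (v + v)
    exact hM.exists_least (P := fun w => v + v < w ∧ w ∈ X) inferInstance hn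
  have hGu : ∀ v w w' : M, ((v + v < w ∧ w ∈ X) ∧ ∀ u, u < w → ¬ (v + v < u ∧ u ∈ X)) →
      ((v + v < w' ∧ w' ∈ X) ∧ ∀ u, u < w' → ¬ (v + v < u ∧ u ∈ X)) → w = w' :=
    fun v w w' h h' =>
      le_antisymm (not_lt.1 fun hw => h.2 w' hw h'.1) (not_lt.1 fun hw => h'.2 w hw h.1)
  obtain ⟨f, F, hf0, hf, hF⟩ := hM.exists_iterate hG hGe hGu m
  have hfX : ∀ n, f n ∈ X := by
    intro n
    rcases hM.eq_zero_or_succ n with rfl | ⟨n, rfl⟩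
    · rwa [hf0]
    · exact (hf n).1.2
  have hlt : ∀ n, f n < f (n + 1) := fun n => le_self_add.trans_lt (hf n).1.1
  refine ⟨f, F, hF, hfX, fun n => (hf n).1.1, fun l n hln => ?_, fun n => ?_⟩
  -- As `f` is not a term, the induction formula names its value by a witness `v` through the graph
  -- `F`.
  · obtain ⟨v, hv, h⟩ := hM.sigma_induction (P := fun n v => mpair n v ∈ F ∧ (l < n → f l < v))
      inferInstance ⟨f 0, (hF _ _).2 rfl, fun h => absurd h _root_.not_lt_zero⟩
      (fun n ⟨v, hv, h⟩ => ⟨f (n + 1), (hF _ _).2 rfl, fun h' => by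
        rw [hF] at hv
        subst hv
        rcases (hM.lt_add_one_iff.1 h').lt_or_eq with h' | rfl
        · exact (h h').trans (hlt n)
        · exact hlt l⟩) n
    rw [hF] at hv
    subst hv
    exact h hln
  · obtain ⟨v, hv, h⟩ := hM.sigma_induction (P := fun n v => mpair n v ∈ F ∧ n ≤ v)
      inferInstance ⟨f 0, (hF _ _).2 rfl, zero_le⟩
      (fun n ⟨v, hv, h⟩ => ⟨f (n + 1), (hF _ _).2 rfl, by
        rw [hF] at hv
        subst hv
        exact hM.add_one_le_iff.2 (h.trans_lt (hlt n))⟩) n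
    rw [hF] at hv
    subst hv
    exact h

/-- The desired set consists of the differences of a sparse sequence in the homogeneous set. Its
adjacent sums telescope to differences of members of that sequence. -/
theorem IsModel.aht_of_zrt (hM : IsModel M V) (d : ℕ) (h : ZRTHolds M V (d + 1)) :
    AHTdHolds M V d := by
  intro C k hC
  obtain ⟨A, hA1, hA2⟩ := hM.exists_difference_colouring d C
  have hcol : IsColouring (d + 1) (Inc (d + 1)) k A := by
    refine ⟨?_, ?_⟩
    · intro z hz
      obtain ⟨f, j, hf, rfl⟩ := hA1 z hz
      obtain ⟨g, hg⟩ := exists_differences hf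
      exact ⟨f, j, hf, hC.lt hM ((hA2 f g j hg).1 hz), rfl⟩
    · intro f hf
      obtain ⟨g, hg⟩ := exists_differences hf
      simp only [hA2 f g _ hg]
      exact hC.2 g trivial
  have hinv : ∀ (f : ℕ → M) (z j : M), Inc (d + 1) f → (mpair (tup (d + 1) f) j ∈ A ↔
      mpair (tup (d + 1) fun i => f i + z) j ∈ A) := by
    intro f z j hf
    obtain ⟨g, hg⟩ := exists_differences hf
    rw [hA2 f g j hg, hA2 (fun i => f i + z) g j fun i hi => ⟨(hg i hi).1, ?_⟩]
    rw [(hg i hi).2, add_right_comm]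
  obtain ⟨X, hX, c, hc⟩ := h A k hcol hinv
  obtain ⟨f, F, hF, hfX, hf, hmono, hle⟩ := hM.exists_sparse_sequence hX
  -- In `E`, `S` and `Y`, the number `u` is the sequence member at which a difference `v` starts.
  -- Sparsity gives `u < v`, which is what makes the three definitions bounded.
  obtain ⟨E, hE1, hE2⟩ := hM.exists_set_of_pairs (V := V) (P := fun n v =>
    ∃ u, u < v ∧ mpair n u ∈ F ∧ mpair (n + 1) (u + v) ∈ F) inferInstance
  obtain ⟨S, hS1, hS2⟩ := hM.exists_set_of_pairs (V := V) (P := fun p v =>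
    ∃ m, m < p + 1 ∧ ∃ n, n < p + 1 ∧ p = mpair m n ∧ m ≤ n ∧
      ∃ u, u < v ∧ mpair m u ∈ F ∧ mpair (n + 1) (u + v) ∈ F) inferInstance
  obtain ⟨Y, hY⟩ := hM.exists_set (V := V) (P := fun v =>
    ∃ n, n < v ∧ ∃ u, u < v ∧ mpair n u ∈ F ∧ mpair (n + 1) (u + v) ∈ F) inferInstance
  simp only [hF] at hE2 hS2 hY
  -- From 2 f(n) < f(n+1) = f(m) + v ≤ f(n) + v.
  have hlt : ∀ {m n v}, m ≤ n → f (n + 1) = f m + v → f n < v := by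
    intro m n v hmn h
    have h1 := hf n
    rw [h] at h1
    exact lt_of_add_lt_add_left (h1.trans_le (add_le_add_left (hmono.monotone hmn) v))
  have hE : ∀ n v, mpair n v ∈ E ↔ f (n + 1) = f n + v := by
    intro n v
    rw [hE2]
    constructor
    · rintro ⟨u, -, rfl, h⟩
      exact h
    · exact fun h => ⟨f n, hlt le_rfl h, rfl, h⟩
  have hS : ∀ m n v, mpair (mpair m n) v ∈ S ↔ m ≤ n ∧ f (n + 1) = f m + v := by
    intro m n v
    rw [hS2]
    constructor
    · rintro ⟨m', -, n', -, h1, h2, u, -, h3, h4⟩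
      obtain ⟨rfl, rfl⟩ := hM.mpair_inj.1 h1
      subst h3
      exact ⟨h2, h4⟩
    · rintro ⟨h1, h2⟩
      exact ⟨m, hM.lt_add_one_iff.2 (left_le_mpair _ _), n,
        hM.lt_add_one_iff.2 (hM.right_le_mpair _ _), rfl, h1, f m,
        (hmono.monotone h1).trans_lt (hlt h1 h2), rfl, h2⟩
  have hex : ∀ {m n}, m ≤ n → ∃ v, f (n + 1) = f m + v := fun h =>
    exists_add_of_le (hmono.monotone (h.trans le_self_add))
  refine ⟨Y, fun m => ?_, E, ⟨⟨hE1, fun m => ?_⟩, fun m n v w hmn hv hw => ?_, fun v => ?_⟩,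
    S, ⟨⟨fun z hz => ?_, fun m n hmn => ?_⟩, fun m v => ?_, fun m n v w hmn hv hw => ?_⟩,
    c, fun a g _ _ hg => ?_⟩
  · obtain ⟨v, hv⟩ := hex (le_refl m)
    have h1 := (hle m).trans_lt (hlt le_rfl hv)
    exact ⟨v, h1, (hY v).2 ⟨m, h1, f m, hlt le_rfl hv, rfl, hv⟩⟩
  · obtain ⟨v, hv⟩ := hex (le_refl m)
    refine ⟨v, (hE _ _).2 hv, fun v' hv' => ?_⟩
    rw [hE, hv] at hv'
    exact (add_left_cancel hv').symm
  · rw [hE] at hv hw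
    calc v ≤ f (m + 1) := hv ▸ le_add_self
      _ ≤ f n := hmono.monotone (hM.add_one_le_iff.2 hmn)
      _ < w := hlt le_rfl hw
  · rw [hY]
    simp only [hE]
    constructor
    · rintro ⟨n, -, u, -, rfl, h⟩
      exact ⟨n, h⟩
    · rintro ⟨n, h⟩
      exact ⟨n, (hle n).trans_lt (hlt le_rfl h), f n, hlt le_rfl h, rfl, h⟩
  · obtain ⟨p, v, rfl⟩ := hS1 z hz
    obtain ⟨m, -, n, -, rfl, h, -⟩ := (hS2 _ _).1 hz
    exact ⟨m, n, v, h, rfl⟩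
  · obtain ⟨v, hv⟩ := hex hmn
    refine ⟨v, (hS _ _ _).2 ⟨hmn, hv⟩, fun v' hv' => ?_⟩
    rw [hS, hv] at hv'
    exact (add_left_cancel hv'.2).symm
  · rw [hS, hE]
    exact and_iff_right le_rfl
  · rw [hS] at hv ⊢
    rw [hE] at hw
    exact ⟨hmn.trans le_self_add, by rw [hw, hv.2, add_assoc]⟩
  -- A block ending at index n has upper endpoint f(n+1), where the next block starts, so the `g i`
  -- are the successive differences of one increasing tuple from `X`.
  · have hdiff : ∀ i < d, 0 < g i ∧ f (startAt a (i + 1)) = f (startAt a i) + g i := by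
      intro i hi
      obtain ⟨h1, h2⟩ := (hS _ _ _).1 (hg i hi)
      exact ⟨zero_le.trans_lt (hlt h1 h2), h2⟩
    exact (hA2 (fun i => f (startAt a i)) g c hdiff).1
      (hc _ (inc_of_differences hdiff) fun i _ => hfX _)

/-! ## From the Hindman theorem to the Ramsey theorem -/

/-- The colouring of tuples by the colour of their partial sums. -/
theorem IsModel.exists_sum_colouring (hM : IsModel M V) (d : ℕ) (C : V) :
    ∃ A : V, (∀ z : M, z ∈ A → ∃ (g : ℕ → M) (j : M), z = mpair (tup d g) j) ∧
      ∀ (g : ℕ → M) (j : M), mpair (tup d g) j ∈ A ↔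
        (∀ i < d, 0 < g i) ∧ mpair (tup (d + 1) fun i => ∑ l ∈ Finset.range i, g l) j ∈ C ∨
        ¬ (∀ i < d, 0 < g i) ∧ j = 0 := by
  have htup : ∀ {g g' : ℕ → M}, (∀ i < d, g i = g' i) →
      (tup (d + 1) fun i => ∑ l ∈ Finset.range i, g l) =
        tup (d + 1) fun i => ∑ l ∈ Finset.range i, g' l := by
    refine fun h => tup_congr fun i hi => Finset.sum_congr rfl fun l hl => h l ?_
    rw [Finset.mem_range] at hl
    omega
  have hpos : ∀ {g g' : ℕ → M}, (∀ i < d, g i = g' i) →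
      ((∀ i < d, 0 < g i) ↔ ∀ i < d, 0 < g' i) := fun h =>
    forall_congr' fun i => imp_congr_right fun hi => by rw [h i hi]
  have key : ∃ A : V, ∀ z : M, z ∈ A ↔ ∃ v : ℕ → M, z = mpair (tup d v) (v d) ∧
      ((∀ i, i < d → 0 < v i) ∧
        mpair (tup (d + 1) fun i => ∑ l ∈ Finset.range i, v l) (v d) ∈ C ∨
      ¬ (∀ i, i < d → 0 < v i) ∧ v d = 0) := by
    refine hM.exists_set_of_tuples (d + 1) (by infer_instance) ?_ ?_
    · rintro z v ⟨rfl, -⟩ i hi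
      rcases (Nat.lt_succ_iff.1 hi).lt_or_eq with hi | rfl
      · exact (hM.le_tup v hi).trans (left_le_mpair _ _)
      · exact hM.right_le_mpair _ _
    · intro z v v' hv h
      have h1 : ∀ i < d, v i = v' i := fun i hi => hv i (by omega)
      rw [← hv d (by omega), ← tup_congr h1, ← htup h1, ← hpos h1]
      exact h
  obtain ⟨A, hA⟩ := key
  refine ⟨A, fun z hz => ?_, fun g j => ?_⟩
  · obtain ⟨v, h, -⟩ := (hA z).1 hz
    exact ⟨v, v d, h⟩
  · rw [hA]
    constructor
    · rintro ⟨v, h1, h2⟩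
      obtain ⟨h3, rfl⟩ := hM.mpair_inj.1 h1
      have h4 := hM.tup_inj h3
      rwa [htup h4, hpos h4]
    · intro h
      have h1 : ∀ i < d, g i = if i < d then g i else j := fun i hi => (if_pos hi).symm
      refine ⟨fun i => if i < d then g i else j, ?_⟩
      simp only [lt_irrefl, if_false]
      rw [← tup_congr h1, ← htup h1, ← hpos h1]
      exact ⟨rfl, h⟩

/-- The sum of an interval of indices, split into two. -/
theorem IsModel.sum_split (hM : IsModel M V) {X E S : V} (hE : IsEnum (M := M) X E)
    (hS : IsSums (M := M) E S) {n u : M} (hu : mpair (mpair 0 n) u ∈ S) {m : M} (hnm : n < m) :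
    ∃ v, 0 < v ∧ mpair (mpair (n + 1) m) v ∈ S ∧ mpair (mpair 0 m) (u + v) ∈ S := by
  have hP : IsBounded V fun e : ℕ → M => n < e 0 →
      0 < e 1 ∧ mpair (mpair (n + 1) (e 0)) (e 1) ∈ S ∧ mpair (mpair 0 (e 0)) (u + e 1) ∈ S :=
    inferInstance
  refine (hM.sigma_induction (P := fun m v => n < m →
    0 < v ∧ mpair (mpair (n + 1) m) v ∈ S ∧ mpair (mpair 0 m) (u + v) ∈ S) hP
    ⟨0, fun h => absurd h _root_.not_lt_zero⟩ ?_ m).imp fun v hv => hv hnm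
  rintro m ⟨v, hv⟩
  obtain ⟨w', hw', -⟩ := hE.1.2 m
  obtain ⟨w, hw, -⟩ := hE.1.2 (m + 1)
  -- Only the first member of the enumeration can be 0.
  have hw0 : 0 < w := zero_le.trans_lt (hE.2.1 _ _ _ _ (lt_add_one m) hw' hw)
  rcases lt_trichotomy n m with h | rfl | h
  · obtain ⟨h1, h2, h3⟩ := hv h
    refine ⟨v + w, fun _ => ⟨by positivity, hS.2.2 _ _ _ _ (hM.add_one_le_iff.2 h) h2 hw, ?_⟩⟩
    rw [← add_assoc]
    exact hS.2.2 _ _ _ _ zero_le h3 hw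
  · exact ⟨w, fun _ => ⟨hw0, (hS.2.1 _ _).2 hw, hS.2.2 _ _ _ _ zero_le hu hw⟩⟩
  · exact ⟨0, fun h' => absurd (hM.lt_add_one_iff.1 h') (not_le.2 h)⟩

/-- Each summand after the first adds at least 1. This bounds the index in the definition of the set
of initial sums and shows that set to be infinite. -/
theorem IsModel.le_of_sum (hM : IsModel M V) {X E S : V} (hE : IsEnum (M := M) X E)
    (hS : IsSums (M := M) E S) {n u : M} (hu : mpair (mpair 0 n) u ∈ S) : n ≤ u := by
  rcases eq_zero_or_pos n with rfl | hn
  · exact zero_le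
  have key : ∃ v, mpair (mpair 0 n) v ∈ S ∧ n ≤ v := by
    refine hM.sigma_induction (P := fun n v => mpair (mpair 0 n) v ∈ S ∧ n ≤ v)
      (by infer_instance) ?_ ?_ n
    · obtain ⟨v, hv, -⟩ := hS.1.2 0 0 le_rfl
      exact ⟨v, hv, zero_le⟩
    · rintro n ⟨v, hv, h⟩
      obtain ⟨w', hw', -⟩ := hE.1.2 n
      obtain ⟨w, hw, -⟩ := hE.1.2 (n + 1)
      have hw0 : 0 < w := zero_le.trans_lt (hE.2.1 _ _ _ _ (lt_add_one n) hw' hw)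
      exact ⟨v + w, hS.2.2 _ _ _ _ zero_le hv hw, add_le_add h (hM.one_le hw0)⟩
  obtain ⟨v, hv, h⟩ := key
  obtain ⟨t, -, ht⟩ := hS.1.2 0 n zero_le
  rwa [ht u hu, ← ht v hv]

/-- The homogeneous set consists of the sums that start at index 0; the difference of two of them is
an adjacent sum. -/
theorem IsModel.zrt_of_aht (hM : IsModel M V) (d : ℕ) (hd : 1 ≤ d) (h : AHTdHolds M V d) :
    ZRTHolds M V (d + 1) := by
  intro C k hC hinv
  obtain ⟨A, hA1, hA2⟩ := hM.exists_sum_colouring d C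
  have hsum : ∀ {g : ℕ → M}, (∀ i < d, 0 < g i) →
      Inc (d + 1) fun i => ∑ l ∈ Finset.range i, g l := fun {g} hg =>
    inc_of_differences (g := g) fun i hi => ⟨hg i hi, Finset.sum_range_succ _ _⟩
  -- Tuples with a zero entry get the default colour 0, which must lie below `k`; the colour of the
  -- increasing tuple 0, 1, …, d shows that there is room.
  have hk : 0 < k := by
    obtain ⟨j, hj, -⟩ := hC.2 _ (hsum (g := fun _ => 1) fun _ _ => one_pos)
    exact zero_le.trans_lt hj
  have hcol : IsColouring d (fun _ => True) k A := by
    refine ⟨?_, ?_⟩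
    · intro z hz
      obtain ⟨g, j, rfl⟩ := hA1 z hz
      refine ⟨g, j, trivial, ?_, rfl⟩
      rcases (hA2 g j).1 hz with ⟨-, h⟩ | ⟨-, rfl⟩
      · exact hC.lt hM h
      · exact hk
    · intro g _
      simp only [hA2]
      by_cases hg : ∀ i < d, 0 < g i
      · obtain ⟨j, h1, h2, h3⟩ := hC.2 _ (hsum hg)
        exact ⟨j, h1, .inl ⟨hg, h2⟩, fun j' h => h.elim (fun h => h3 j' h.2) fun h => absurd hg h.1⟩
      · exact ⟨0, hk, .inr ⟨hg, rfl⟩, fun j' h => h.elim (fun h => absurd h.1 hg) fun h => h.2⟩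
  obtain ⟨Y, -, E, hE, S, hS, c, hc⟩ := h A k hcol
  have huniq : ∀ {n u v : M}, mpair (mpair 0 n) u ∈ S → mpair (mpair 0 n) v ∈ S → u = v := by
    intro n u v hu hv
    obtain ⟨t, -, ht⟩ := hS.1.2 0 n zero_le
    rw [ht u hu, ht v hv]
  obtain ⟨X, hX⟩ := hM.exists_set (V := V)
    (P := fun u => ∃ n, n < u + 1 ∧ mpair (mpair 0 n) u ∈ S) (by infer_instance)
  refine ⟨X, fun m => ?_, c, fun f hf hfX => ?_⟩
  · obtain ⟨v, hv, -⟩ := hS.1.2 0 (m + 1) zero_le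
    have h1 := hM.le_of_sum hE hS hv
    exact ⟨v, hM.add_one_le_iff.1 h1, (hX v).2 ⟨m + 1, hM.lt_add_one_iff.2 h1, hv⟩⟩
  · have ha : ∀ i, ∃ n, i < d + 1 → mpair (mpair 0 n) (f i) ∈ S := by
      intro i
      by_cases hi : i < d + 1
      · obtain ⟨n, -, hn⟩ := (hX _).1 (hfX i hi)
        exact ⟨n, fun _ => hn⟩
      · exact ⟨0, fun h => absurd h hi⟩
    choose a ha using ha
    -- Initial sums grow with their last index, so increasing values come from increasing indices.
    have hinc : ∀ i, i < d → a i < a (i + 1) := by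
      intro i hi
      have h1 := ha i (by omega)
      have h2 := ha (i + 1) (by omega)
      have h3 := hf i (by omega)
      rcases lt_trichotomy (a i) (a (i + 1)) with h4 | h4 | h4
      · exact h4
      · rw [h4] at h1
        exact absurd (huniq h1 h2) h3.ne
      · obtain ⟨v, -, -, h5⟩ := hM.sum_split hE hS h2 h4
        have h6 : f (i + 1) ≤ f i := by rw [huniq h1 h5]; exact le_self_add
        exact absurd h6 (not_le.2 h3)
    have hg : ∀ i, ∃ v, i < d → 0 < v ∧ mpair (mpair (a i + 1) (a (i + 1))) v ∈ S ∧
        f (i + 1) = f i + v := by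
      intro i
      by_cases hi : i < d
      · obtain ⟨v, h1, h2, h3⟩ := hM.sum_split hE hS (ha i (by omega)) (hinc i hi)
        exact ⟨v, fun _ => ⟨h1, h2, huniq (ha (i + 1) (by omega)) h3⟩⟩
      · exact ⟨0, fun h => absurd h hi⟩
    choose g hg using hg
    have hpos : ∀ i < d, 0 < g i := fun i hi => (hg i hi).1
    -- Only the first block starts at its index without an added 1, so index 0 is set to `a 0 + 1`
    -- to skip the initial sum `f 0`.
    have hstart : ∀ i, startAt (fun i => if i = 0 then a 0 + 1 else a i) i = a i + 1 := by
      intro i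
      cases i <;> simp [startAt]
    have h1 := hc (fun i => if i = 0 then a 0 + 1 else a i) g
      (by simpa using hM.add_one_le_iff.2 (hinc 0 hd))
      (fun i hi => by simpa using hinc (i + 1) hi)
      (fun i hi => by rw [hstart]; simpa using (hg i hi).2.1)
    rw [hA2] at h1
    rcases h1 with ⟨-, h1⟩ | ⟨h1, -⟩
    -- The colour found belongs to the tuple of partial sums starting at 0; translation by `f 0`
    -- turns it into `f`.
    · rw [hinv _ (f 0) _ (hsum hpos)] at h1
      rwa [tup_congr (g := fun i => (∑ l ∈ Finset.range i, g l) + f 0)]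
      intro i
      induction i with
      | zero => simp
      | succ i ih =>
        intro hi
        rw [(hg i (by omega)).2.2, ih (by omega), Finset.sum_range_succ, add_right_comm]
    · exact absurd hpos h1

/-- The forms differ only in giving the last index directly or as an offset from the first. -/
theorem ahtdHolds_one : AHTdHolds M V 1 ↔ AHTHolds M V := by
  refine forall₃_congr fun C k _ => exists_congr fun X => and_congr_right fun _ =>
    exists_congr fun E => and_congr_right fun _ => exists_congr fun S => and_congr_right fun _ =>
    exists_congr fun c => ?_
  constructor
  · intro h m n v hv
    refine h (fun i => if i = 0 then m else m + n) (fun _ => v) (by simp) (fun i hi => by omega)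
      fun i hi => ?_
    obtain rfl : i = 0 := by omega
    simpa [startAt] using hv
  · intro h f g h1 _ h2
    obtain ⟨l, hl⟩ := exists_add_of_le h1
    have h3 := h2 0 one_pos
    simp only [startAt, zero_add, hl] at h3
    exact h _ _ _ h3

end Equivalence

/-- A formula that holds in the ordered semirings with sets that are models of `RCA₀` is provable
in `RCA₀`. -/
theorem rca0_proves {φ : Fm}
    (h : ∀ (M V : Type) [CommSemiring M] [LinearOrder M] [IsStrictOrderedRing M]
      [CanonicallyOrderedAdd M] [Membership M V] [Nonempty V], IsModel M V →
        ∀ (e : ℕ → M) (r : ℕ → V), φ.Sat e r) : Proves RCA0 φ := by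
  refine completeness fun M V _ _ _ _ _ _ hM e r => ?_
  have hM : IsModel M V := hM
  -- A set environment already provides a set.
  have : Nonempty V := ⟨r 0⟩
  let _ := hM.commSemiring
  let _ := hM.linearOrder
  have := hM.isStrictOrderedRing
  have := hM.canonicallyOrderedAdd
  exact h M V hM e r

end SOA

theorem corollary3 :
    (∀ d : ℕ, 1 ≤ d → SOA.Proves SOA.RCA0 (SOA.ZRT (d + 1) ⭤ SOA.AHTd d)) ∧
      SOA.Proves SOA.RCA0 (SOA.AHT ⭤ SOA.ZRT 2) := by
  refine ⟨fun d hd => SOA.rca0_proves fun M V _ _ _ _ _ _ hM e r => ?_,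
    SOA.rca0_proves fun M V _ _ _ _ _ _ hM e r => ?_⟩
  · rw [SOA.Fm.sat_iff, SOA.sat_ZRT, SOA.sat_AHTd d hd]
    exact ⟨hM.aht_of_zrt d, hM.zrt_of_aht d hd⟩
  · rw [SOA.Fm.sat_iff, SOA.sat_ZRT, SOA.sat_AHT, ← SOA.ahtdHolds_one]
    exact ⟨hM.zrt_of_aht 1 le_rfl, hM.aht_of_zrt 1⟩
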